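/- Let $\mathbb K$ be a field and let $q\in\mathbb K$, $q\neq 0$, with $q^m\neq 1$ for all $m\ge 1$; put $m_q=\frac{q^m-q^{-m}}{q-q^{-1}}$. Let $V=\mathbb K^n$ and let $R\in\mathrm{End}(V^{\otimes 2})$ satisfy the Yang--Baxter equation $R_{12}R_{23}R_{12}=R_{23}R_{12}R_{23}$ and the Hecke condition $(R-qI)(R+q^{-1}I)=0$. Tensors are treated as matrices whose rows are labelled by lower and columns by upper indices. Define the $q$-antisymmetrizers by $A^{(1)}=I$ and $$A^{(m+1)}=\tfrac{1}{(m+1)_q}\,A^{(m)}\bigl(q^{m}I-m_qR_{m,m+1}\bigr)A^{(m)},$$ and assume that $R$ is even of symmetry rank $p\ge 1$: $A^{(p+1)}=0$ and $\operatorname{rank}A^{(p)}=1$. Assume that $R$ is skew-invertible, that is, there is $\Psi\in \mathrm{End}(V^{\otimes 2})$ with $\mathrm{Tr}_{(2)}R_{12}\Psi_{23}=P_{13}=\mathrm{Tr}_{(2)}\Psi_{12}R_{23}$, where $P$ is the flip. Put $C=\mathrm{Tr}_{(2)}\Psi_{12}$, $\mathrm{Tr}_R(X)=\mathrm{Tr}(CX)$,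 and $\mathrm{Tr}_{R(1\dots k)}(X)=\mathrm{Tr}(C_1\cdots C_kX)$. Let $\mathcal L_q$ be the reflection equation algebra, the unital associative $\mathbb K$-algebra generated by the entries of $\hat L=\|\hat l_i^{\,j}\|_{1\le i,j\le n}$ with relations $R\hat L_1R\hat L_1=\hat L_1R\hat L_1R$, $\hat L_1=\hat L\otimes I$, and let $Z(\mathcal L_q)$ be its center. Put $\hat L_{\bar 1}=\hat L_1$, $\hat L_{\overline{k+1}}=R_{k,k+1}\hat L_{\bar k}R_{k,k+1}^{-1}$, and $$\sigma_0(\hat L)=1,\qquad \sigma_k(\hat L)=q^k\,\mathrm{Tr}_{R(1\dots k)}\bigl(A^{(k)}\hat L_{\bar 1}\cdots\hat L_{\bar k}\bigr),\qquad s_k(\hat L)=q\,\mathrm{Tr}_R(\hat L^k)\qquad(k\ge 1).$$ For $\mu_1,\dots,\mu_p$ in a commutative $\mathbb K$-algebra whose differences $\mu_i-\mu_j$ $(i\ne j)$ are invertible (for a field: pairwise distinct $\mu_i$), let $e_k(\mu)=\sum_{i_1<\dots<i_k}\mu_{i_1}\cdots\mu_{i_k}$ and $$d_i=\prod_{j\neq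 i}\frac{q\mu_i-q^{-1}\mu_j}{\mu_i-\mu_j}.$$ Then: 1. The elements $\sigma_k(\hat L)$ and $\mathrm{Tr}_R(\hat L^k)$ are central in $\mathcal L_q$, and they satisfy the $q$-Newton identities $$\sum_{i=1}^{k}(-1)^{i-1}s_i\,\sigma_{k-i}=k_q\,q^{1-k}\,\sigma_k,\qquad 1\le k\le p.$$ 2. For every commutative $\mathbb K$-algebra $S$ and every $\mu_1,\dots,\mu_p\in S$ with invertible differences, elements $s_1,\dots,s_p\in S$ satisfy the $q$-Newton identities with $\sigma_k=e_k(\mu)$ if and only if $s_k=q^{1-p}\sum_{i=1}^p\mu_i^kd_i$ for $1\le k\le p$. 3. Let $S$ be a commutative $\mathbb K$-algebra, $\varphi:Z(\mathcal L_q)\to S$ a homomorphism of $\mathbb K$-algebras (for example an extension of the center, or a character of it), and $\mu_1,\dots,\mu_p\in S$ elements with invertible differences that parametrize the $\sigma_k$, that is, $\varphi(\sigma_k(\hat L))=e_k(\mu)$ for $1\le k\le p$. Then, for all $k\ge 1$, $$\varphi\bigl(\mathrm{Tr}_R(\hat L^k)\bigr)=q^{-p}\sum_{i=1}^p\mu_i^k\,d_i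 .$$ 4. For pairwise distinct $\mu_1,\dots,\mu_p\in\mathbb K$, in the quotient of $\mathcal L_q$ by the two-sided ideal generated by $\sigma_k(\hat L)-e_k(\mu)$, $1\le k\le p$ (the non-commutative orbit), one has $\mathrm{Tr}_R(\hat L^k)=q^{-p}\sum_{i=1}^p\mu_i^k\,d_i$ for all $k\ge 1$. -/

import Mathlib

/-!
Hecke symmetries, the reflection equation algebra and its characteristic subalgebra.
A tensor `X` with lower indices `i₁ … i_m` and upper indices `j₁ … j_m` is the matrix with row
index `(i₁, …, i_m)` and column index `(j₁, …, j_m)`; products are products of matrices.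
Tensor factors (sites) are numbered from `0`.
-/

noncomputable section

namespace ReflectionEquation

open scoped Kronecker

/-- The `q`-number `m_q = (q^m - q^{-m}) / (q - q^{-1})`. -/
def qNumber {K : Type*} [Field K] (q : K) (m : ℕ) : K :=
  (q ^ m - (q⁻¹) ^ m) / (q - q⁻¹)

/-- `q` is nonzero and not a root of unity. -/
def IsGeneric {K : Type*} [Field K] (q : K) : Prop :=
  q ≠ 0 ∧ ∀ m : ℕ, 1 ≤ m → q ^ m ≠ 1

/-- For an endomorphism `X` of `V ⊗ V`, the endomorphism `I ⊗ … ⊗ X ⊗ … ⊗ I` of `V^{⊗N}` with `X`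
in the sites `i, i + 1`. It is used only for `i + 1 < N`. -/
def atPair {K : Type*} [Field K] {n : ℕ} (X : Matrix (Fin n × Fin n) (Fin n × Fin n) K)
    (N i : ℕ) : Matrix (Fin N → Fin n) (Fin N → Fin n) K :=
  if h : i + 1 < N then
    Matrix.of fun f g =>
      if ∀ j : Fin N, (j : ℕ) ≠ i → (j : ℕ) ≠ i + 1 → f j = g j then
        X (f ⟨i, by omega⟩, f ⟨i + 1, h⟩) (g ⟨i, by omega⟩, g ⟨i + 1, h⟩)
      else 0
  else 1

/-- The `q`-antisymmetrizer `A^{(m)}` built on the first `m` sites, as an endomorphism of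
`V^{⊗N}` (`m ≤ N`): `A^{(1)} = I` and
`A^{(m+1)} = ((m+1)_q)⁻¹ A^{(m)} (q^m I - m_q R_{m,m+1}) A^{(m)}`. It is the image, under the local
representation, of the idempotent of the Hecke algebra that belongs to the one-column Young
diagram with `m` boxes. -/
def antisymm {K : Type*} [Field K] {n : ℕ} (q : K)
    (R : Matrix (Fin n × Fin n) (Fin n × Fin n) K) (N : ℕ) :
    ℕ → Matrix (Fin N → Fin n) (Fin N → Fin n) K
  | 0 => 1
  | 1 => 1
  | m + 2 =>
      (qNumber q (m + 2))⁻¹ •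
        (antisymm q R N (m + 1) *
          (q ^ (m + 1) • (1 : Matrix (Fin N → Fin n) (Fin N → Fin n) K)
            - qNumber q (m + 1) • atPair R N m) *
          antisymm q R N (m + 1))

/-- `R` is an even Hecke symmetry of symmetry rank `p`: it satisfies the Yang-Baxter equation and
the Hecke condition, `A^{(p+1)} = 0` on `V^{⊗(p+1)}`, and `A^{(p)}` has rank one on `V^{⊗p}`. -/
structure IsEvenHeckeSymmetry {K : Type*} [Field K] {n : ℕ} (q : K) (p : ℕ)
    (R : Matrix (Fin n × Fin n) (Fin n × Fin n) K) : Prop where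
  yang_baxter : atPair R 3 0 * atPair R 3 1 * atPair R 3 0
    = atPair R 3 1 * atPair R 3 0 * atPair R 3 1
  hecke : (R - q • (1 : Matrix (Fin n × Fin n) (Fin n × Fin n) K)) *
    (R + q⁻¹ • (1 : Matrix (Fin n × Fin n) (Fin n × Fin n) K)) = 0
  rank_pos : 0 < p
  antisymm_succ : antisymm q R (p + 1) (p + 1) = 0
  rank_antisymm : (antisymm q R p p).rank = 1

/-- `Ψ` is the skew inverse of `R`:
`∑_{a,b} R_{ia}^{jb} Ψ_{bk}^{as} = δ_i^s δ_k^j = ∑_{a,b} Ψ_{ia}^{jb} R_{bk}^{as}`. -/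
structure IsSkewInverse {K : Type*} [Field K] {n : ℕ}
    (R Ψ : Matrix (Fin n × Fin n) (Fin n × Fin n) K) : Prop where
  right : ∀ i j k s : Fin n, ∑ a, ∑ b, R (i, a) (j, b) * Ψ (b, k) (a, s)
    = if i = s ∧ k = j then 1 else 0
  left : ∀ i j k s : Fin n, ∑ a, ∑ b, Ψ (i, a) (j, b) * R (b, k) (a, s)
    = if i = s ∧ k = j then 1 else 0

/-- The endomorphism `C = Tr_{(2)} Ψ_{12}` of `V`. -/
def cMatrix {K : Type*} [Field K] {n : ℕ} (Ψ : Matrix (Fin n × Fin n) (Fin n × Fin n) K) :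
    Matrix (Fin n) (Fin n) K :=
  Matrix.of fun i j => ∑ a, Ψ (i, a) (j, a)

/-- The two sides `R L₁ R L₁` and `L₁ R L₁ R`, `L₁ = L ⊗ I`, of the reflection equation, entry by
entry, for the matrix `L` of free generators. -/
inductive RERel {K : Type*} [Field K] {n : ℕ}
    (R : Matrix (Fin n × Fin n) (Fin n × Fin n) K) :
    FreeAlgebra K (Fin n × Fin n) → FreeAlgebra K (Fin n × Fin n) → Prop
  | entry (x y : Fin n × Fin n) :
      RERel R
        (((R.map (algebraMap K (FreeAlgebra K (Fin n × Fin n)))) *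
          ((Matrix.of fun i j : Fin n => FreeAlgebra.ι K (i, j)) ⊗ₖ
            (1 : Matrix (Fin n) (Fin n) (FreeAlgebra K (Fin n × Fin n)))) *
          (R.map (algebraMap K (FreeAlgebra K (Fin n × Fin n)))) *
          ((Matrix.of fun i j : Fin n => FreeAlgebra.ι K (i, j)) ⊗ₖ
            (1 : Matrix (Fin n) (Fin n) (FreeAlgebra K (Fin n × Fin n))))) x y)
        ((((Matrix.of fun i j : Fin n => FreeAlgebra.ι K (i, j)) ⊗ₖ
            (1 : Matrix (Fin n) (Fin n) (FreeAlgebra K (Fin n × Fin n)))) *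
          (R.map (algebraMap K (FreeAlgebra K (Fin n × Fin n)))) *
          ((Matrix.of fun i j : Fin n => FreeAlgebra.ι K (i, j)) ⊗ₖ
            (1 : Matrix (Fin n) (Fin n) (FreeAlgebra K (Fin n × Fin n)))) *
          (R.map (algebraMap K (FreeAlgebra K (Fin n × Fin n))))) x y)

/-- The (non-modified) reflection equation algebra of `R`: the unital associative algebra with
generators `l_i^j` and relations `R L₁ R L₁ = L₁ R L₁ R`. -/
abbrev REA {K : Type*} [Field K] {n : ℕ} (R : Matrix (Fin n × Fin n) (Fin n × Fin n) K) : Type _ :=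
  RingQuot (RERel R)

/-- The matrix `L̂ = ‖l_i^j‖` of the generators. -/
def genMatrix {K : Type*} [Field K] {n : ℕ} (R : Matrix (Fin n × Fin n) (Fin n × Fin n) K) :
    Matrix (Fin n) (Fin n) (REA R) :=
  Matrix.of fun i j => RingQuot.mkAlgHom K (RERel R) (FreeAlgebra.ι K (i, j))

/-- The `R`-trace `Tr_R X = Tr (C X)` of a matrix over a `K`-algebra. -/
def rTrace {K : Type*} [Field K] {n : ℕ} {A : Type*} [Ring A] [Algebra K A]
    (Ψ : Matrix (Fin n × Fin n) (Fin n × Fin n) K) (X : Matrix (Fin n) (Fin n) A) : A :=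
  Matrix.trace ((cMatrix Ψ).map (algebraMap K A) * X)

/-- The `R`-trace `Tr_{R(1…N)} X = Tr (C₁ ⋯ C_N X)` over all sites of `V^{⊗N}`. -/
def rTraceSites {K : Type*} [Field K] {n : ℕ} {A : Type*} [Ring A] [Algebra K A]
    (Ψ : Matrix (Fin n × Fin n) (Fin n × Fin n) K) (N : ℕ)
    (X : Matrix (Fin N → Fin n) (Fin N → Fin n) A) : A :=
  Matrix.trace
    ((Matrix.of fun f g : Fin N → Fin n =>
      algebraMap K A (∏ i, cMatrix Ψ (f i) (g i))) * X)

/-- The matrix `L ⊗ I ⊗ … ⊗ I` on `V^{⊗N}`, with `L` in the site `0`. -/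
def atFirst {n : ℕ} {A : Type*} [Ring A] (L : Matrix (Fin n) (Fin n) A) (N : ℕ) :
    Matrix (Fin N → Fin n) (Fin N → Fin n) A :=
  if h : 0 < N then
    Matrix.of fun f g =>
      if ∀ j : Fin N, (j : ℕ) ≠ 0 → f j = g j then L (f ⟨0, h⟩) (g ⟨0, h⟩) else 0
  else 1

/-- The matrices `L_{\bar 1} = L₁` and `L_{\overline{k+1}} = R_k L_{\bar k} R_k⁻¹` on `V^{⊗N}`;
`lBar R L N k` is `L_{\overline{k+1}}`. -/
def lBar {K : Type*} [Field K] {n : ℕ} {A : Type*} [Ring A] [Algebra K A]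
    (R : Matrix (Fin n × Fin n) (Fin n × Fin n) K) (L : Matrix (Fin n) (Fin n) A) (N : ℕ) :
    ℕ → Matrix (Fin N → Fin n) (Fin N → Fin n) A
  | 0 => atFirst L N
  | k + 1 => (atPair R N k).map (algebraMap K A) * lBar R L N k *
      (atPair R⁻¹ N k).map (algebraMap K A)

/-- `σ_k(L̂) = q^k Tr_{R(1…k)} (A^{(k)} L̂_{\bar 1} ⋯ L̂_{\bar k})`. For `k = 0` this is `1`. -/
def sigma {K : Type*} [Field K] {n : ℕ} (q : K)
    (R Ψ : Matrix (Fin n × Fin n) (Fin n × Fin n) K) (k : ℕ) : REA R :=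
  q ^ k • rTraceSites Ψ k
    ((antisymm q R k k).map (algebraMap K (REA R)) *
      (List.ofFn fun i : Fin k => lBar R (genMatrix R) k i).prod)

/-- `s_k(L̂) = q Tr_R (L̂^k)`, for `k ≥ 1`. -/
def powerSum {K : Type*} [Field K] {n : ℕ} (q : K)
    (R Ψ : Matrix (Fin n × Fin n) (Fin n × Fin n) K) (k : ℕ) : REA R :=
  q • rTrace Ψ (genMatrix R ^ k)

/-- The `q`-Newton identities
`∑_{i=1}^{k} (-1)^{i-1} s_i σ_{k-i} = k_q q^{1-k} σ_k` for `1 ≤ k ≤ p`. -/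
def NewtonIdentities {K : Type*} [Field K] {A : Type*} [Ring A] [Algebra K A] (q : K) (p : ℕ)
    (s σ : ℕ → A) : Prop :=
  ∀ k : ℕ, 1 ≤ k → k ≤ p →
    ∑ i ∈ Finset.Icc 1 k, (-1) ^ (i - 1) * (s i * σ (k - i))
      = (qNumber q k * (q⁻¹) ^ (k - 1)) • σ k

/-- The elementary symmetric function `e_k(μ_1, …, μ_p)`. -/
def elemSymm {S : Type*} [CommRing S] {p : ℕ} (μ : Fin p → S) (k : ℕ) : S :=
  ∑ t ∈ Finset.powersetCard k Finset.univ, ∏ i ∈ t, μ i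

/-- `d_i = ∏_{j ≠ i} (q μ_i - q⁻¹ μ_j) / (μ_i - μ_j)`, in a commutative algebra in which the
differences `μ_i - μ_j` with `i ≠ j` are invertible. -/
def dCoeff {K : Type*} [Field K] {S : Type*} [CommRing S] [Algebra K S] (q : K) {p : ℕ}
    (μ : Fin p → S) (i : Fin p) : S :=
  ∏ j ∈ Finset.univ.erase i, (q • μ i - q⁻¹ • μ j) * Ring.inverse (μ i - μ j)

/-- The relations `σ_k(L̂) = e_k(μ)`, `1 ≤ k ≤ p`, for numbers `μ_1, …, μ_p`. -/
inductive OrbitRel {K : Type*} [Field K] {n : ℕ} (q : K)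
    (R Ψ : Matrix (Fin n × Fin n) (Fin n × Fin n) K) {p : ℕ} (μ : Fin p → K) :
    REA R → REA R → Prop
  | mk (k : ℕ) (hk : 1 ≤ k) (hkp : k ≤ p) :
      OrbitRel q R Ψ μ (sigma q R Ψ k) (algebraMap K (REA R) (elemSymm μ k))

/-- The non-commutative orbit: the quotient of the reflection equation algebra by the two-sided
ideal generated by the elements `σ_k(L̂) - e_k(μ)`, `1 ≤ k ≤ p`. -/
abbrev NCOrbit {K : Type*} [Field K] {n : ℕ} (q : K)
    (R Ψ : Matrix (Fin n × Fin n) (Fin n × Fin n) K) {p : ℕ} (μ : Fin p → K) : Type _ :=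
  RingQuot (OrbitRel q R Ψ μ)

end ReflectionEquation

end

/-!
The Newton identities hold for every `k ≥ 1`, not only for `k ≤ p`, and everything else is formal.

Let `F(m, j) = Tr_{R(1…m)} (A^{(m)} L_{\bar 1} ⋯ L_{\overline{m-1}} L_{\bar m}^j)` (`hookTrace`).
The recursion for the antisymmetrizers reads
`q^m A^{(m)} = (m+1)_q A^{(m+1)} + m_q A^{(m)} R_m A^{(m)}`; multiplied by
`L_{\bar 1} ⋯ L_{\bar m} L_{\overline{m+1}}^j` and traced, it becomes
`σ_m Tr_R L^j = (m+1)_q F(m+1, j) + m_q F(m, j+1)` (`sigmaOf_succ_mul_rTrace`), and the alternating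
sum over `m + j = k` telescopes to a multiple of `F(k, 1) = q^{-k} σ_k`. The computation uses that
`R_i` commutes with `L_{\bar 1} ⋯ L_{\bar m}` for `i < m` and that `R_m L_{\bar m} R_m` commutes
with `L_{\bar m}`, which are formal consequences of the braid relations and the reflection equation
(`IsReflectionFamily`), that `A^{(m)}` is idempotent (`IsHeckeFamily.hAntisymm_mul_self`), and three
properties of the partial `R`-trace over the last site: it sends `R` to `I` (`lastTrace_atPair`), it
is invariant under conjugation by `R` and by `R⁻¹` (`lastTrace_conj`, `lastTrace_conj_inv`), and
`C₁ C₂` commutes with `R` (`IsEvenHeckeSymmetry.commute_cMatrix`). For the invariance it suffices to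
test matrices that are slices of `R`, because skew-invertibility says that they span all matrices;
on slices it is the braid relation.

Tracing out the second site in `L₁ (R L₁^k R⁻¹) = (R⁻¹ L₁^k R) L₁` shows that `Tr_R L^k` is central.
The `σ_k` are then central because the Newton identities express them through the `Tr_R L^k`: no
`k_q` vanishes.

In a commutative algebra the Newton identities with `σ_k = e_k(μ)` have exactly one solution, and it
is the stated one by Lagrange interpolation of `∏ (x + μ_j) - ∏ (x + q⁻² μ_j)` at the points `-μ_l`
(`interpolation`, `newtonIdentities_elemSymm`). Since `σ_k = 0 = e_k(μ)` for `k > p`, uniqueness for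
an arbitrary upper bound on `k` gives the formula for all power sums at once, both for images of
the center and on the orbit.
-/

noncomputable section

namespace ReflectionEquation

open scoped Kronecker

/-! ### Reflection data in a ring -/

/-- Elements `r i` with inverses `r' i` and an element `x` of a ring that satisfy the relations of
the affine braid group on `N` strands: the braid relations among the `r i`, and the reflection
equation between `r 0` and `x`. Only the relations that involve at most `N` strands are required,
which fits families that are continued by `1` beyond the last strand. -/
structure IsReflectionFamily {B : Type*} [Ring B] (N : ℕ) (r r' : ℕ → B) (x : B) : Prop where
  mul_inv : ∀ i, r i * r' i = 1
  inv_mul : ∀ i, r' i * r i = 1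
  braid : ∀ i, i + 2 < N → r i * r (i + 1) * r i = r (i + 1) * r i * r (i + 1)
  far : ∀ i j, i + 2 ≤ j → Commute (r i) (r j)
  far_gen : ∀ i, Commute (r (i + 1)) x
  reflection : 1 < N → r 0 * x * r 0 * x = x * r 0 * x * r 0

/-- The elements `x`, `r₀ x r₀⁻¹`, `r₁ r₀ x r₀⁻¹ r₁⁻¹`, …, with `r' i` in the place of `(r i)⁻¹`;
the matrices `L_{\bar k}` form such a sequence. -/
def conjSeq {B : Type*} [Ring B] (r r' : ℕ → B) (x : B) : ℕ → B
  | 0 => x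
  | k + 1 => r k * conjSeq r r' x k * r' k

section Ring

variable {B : Type*} [Ring B] {N : ℕ} {r r' : ℕ → B} {x : B}

theorem commute_of_mul_eq_one {a b c : B} (hab : a * b = 1) (hba : b * a = 1)
    (h : Commute a c) : Commute b c := by
  have h1 : b * (a * c) * b = b * (c * a) * b := by rw [h.eq]
  have h2 : b * (a * c) * b = c * b := by
    rw [← mul_assoc b a c, hba, one_mul]
  have h3 : b * (c * a) * b = b * c := by
    rw [mul_assoc, mul_assoc c a b, hab, mul_one]
  exact (h3.symm.trans (h1.symm.trans h2))

theorem conj_pow {a b c : B} (hba : b * a = 1) (hab : a * b = 1) (j : ℕ) :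
    (a * c * b) ^ j = a * c ^ j * b := by
  induction j with
  | zero => simp [hab]
  | succ j ih =>
    rw [pow_succ, ih, pow_succ]
    calc a * c ^ j * b * (a * c * b) = a * c ^ j * (b * a) * c * b := by noncomm_ring
      _ = a * (c ^ j * c) * b := by rw [hba]; noncomm_ring

theorem prod_ofFn_succ (l : ℕ → B) (m : ℕ) :
    (List.ofFn fun i : Fin (m + 1) => l i).prod = (List.ofFn fun i : Fin m => l i).prod * l m := by
  rw [List.ofFn_succ', List.prod_concat]
  rfl

namespace IsReflectionFamily

theorem commute_conjSeq_of_lt (h : IsReflectionFamily N r r' x) {i j : ℕ} (hij : j < i) :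
    Commute (r i) (conjSeq r r' x j) := by
  induction j with
  | zero =>
    obtain ⟨i, rfl⟩ : ∃ k, i = k + 1 := ⟨i - 1, by omega⟩
    exact h.far_gen i
  | succ j ih =>
    have h1 : Commute (r j) (r i) := h.far j i (by omega)
    exact ((h1.symm.mul_right (ih (by omega))).mul_right
      (commute_of_mul_eq_one (h.mul_inv j) (h.inv_mul j) h1).symm)

theorem commute_conjSeq_of_add_one_lt (h : IsReflectionFamily N r r' x) {i j : ℕ}
    (hij : i + 1 < j) (hj : j < N) : Commute (r i) (conjSeq r r' x j) := by
  induction j, hij using Nat.le_induction with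
  | base =>
    have hb := h.braid i hj
    have hc := (h.commute_conjSeq_of_lt (Nat.lt_succ_self i)).eq
    have hb' : r' i * r' (i + 1) * r i = r (i + 1) * r' i * r' (i + 1) := by
      calc r' i * r' (i + 1) * r i
          = r' i * r' (i + 1) * (r i * r (i + 1) * r i) * r' i * r' (i + 1) := by
            rw [show r' i * r' (i + 1) * (r i * r (i + 1) * r i) * r' i * r' (i + 1)
              = r' i * r' (i + 1) * r i * (r (i + 1) * (r i * r' i) * r' (i + 1)) by noncomm_ring,
              h.mul_inv, mul_one, h.mul_inv, mul_one]
        _ = r (i + 1) * r' i * r' (i + 1) := by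
            rw [hb, show r' i * r' (i + 1) * (r (i + 1) * r i * r (i + 1)) * r' i * r' (i + 1)
              = r' i * (r' (i + 1) * r (i + 1)) * r i * r (i + 1) * r' i * r' (i + 1) by
                noncomm_ring, h.inv_mul, mul_one, h.inv_mul, one_mul]
    change r i * (r (i + 1) * (r i * conjSeq r r' x i * r' i) * r' (i + 1))
      = r (i + 1) * (r i * conjSeq r r' x i * r' i) * r' (i + 1) * r i
    calc r i * (r (i + 1) * (r i * conjSeq r r' x i * r' i) * r' (i + 1))
        = (r i * r (i + 1) * r i) * conjSeq r r' x i * r' i * r' (i + 1) := by noncomm_ring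
      _ = r (i + 1) * r i * (r (i + 1) * conjSeq r r' x i) * r' i * r' (i + 1) := by
          rw [hb]; noncomm_ring
      _ = r (i + 1) * r i * conjSeq r r' x i * (r (i + 1) * r' i * r' (i + 1)) := by
          rw [hc]; noncomm_ring
      _ = _ := by rw [← hb']; noncomm_ring
  | succ j hij ih =>
    have h1 : Commute (r i) (r j) := h.far i j hij
    exact (h1.mul_right (ih (by omega))).mul_right
      (commute_of_mul_eq_one (h.mul_inv j) (h.inv_mul j) h1.symm).symm

/-- Every element of the sequence satisfies the reflection equation with the next `r m`. -/
theorem reflection_conjSeq (h : IsReflectionFamily N r r' x) {m : ℕ} (hm : m + 1 < N) :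
    r m * conjSeq r r' x m * r m * conjSeq r r' x m
      = conjSeq r r' x m * r m * conjSeq r r' x m * r m := by
  induction m with
  | zero => exact h.reflection hm
  | succ m ih =>
    have hb := h.braid m hm
    have hrec := ih (by omega)
    have hc := (h.commute_conjSeq_of_lt (Nat.lt_succ_self m)).eq
    have hc' := (commute_of_mul_eq_one (h.mul_inv _) (h.inv_mul _)
      (h.commute_conjSeq_of_lt (Nat.lt_succ_self m))).eq
    have hm1 := h.mul_inv m
    have hm2 := h.inv_mul m
    have hn1 := h.mul_inv (m + 1)
    have hn2 := h.inv_mul (m + 1)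
    change r (m + 1) * (r m * conjSeq r r' x m * r' m) * r (m + 1)
        * (r m * conjSeq r r' x m * r' m)
      = (r m * conjSeq r r' x m * r' m) * r (m + 1) * (r m * conjSeq r r' x m * r' m)
        * r (m + 1)
    generalize conjSeq r r' x m = l at *
    generalize r m = a at *
    generalize r' m = a' at *
    generalize r (m + 1) = b at *
    generalize r' (m + 1) = b' at *
    have e1 : a' * b * a = b * a * b' := by
      calc a' * b * a = a' * (b * a * b) * b' := by
            rw [show a' * (b * a * b) * b' = a' * b * a * (b * b') by noncomm_ring, hn1, mul_one]
        _ = (a' * a) * b * a * b' := by rw [← hb]; noncomm_ring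
        _ = _ := by rw [hm2, one_mul]
    have e2 : b' * a' * b = a * b' * a' := by
      calc b' * a' * b = b' * a' * (b * a * b) * b' * a' := by
            rw [show b' * a' * (b * a * b) * b' * a' = b' * a' * b * (a * (b * b') * a') by
              noncomm_ring, hn1, mul_one, hm1, mul_one]
        _ = b' * (a' * a) * b * a * b' * a' := by rw [← hb]; noncomm_ring
        _ = _ := by rw [hm2, mul_one, hn2, one_mul]
    calc b * (a * l * a') * b * (a * l * a')
        = b * a * l * (a' * b * a) * l * a' := by noncomm_ring
      _ = b * a * (l * b) * a * (b' * l) * a' := by rw [e1]; noncomm_ring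
      _ = (b * a * b) * l * a * l * b' * a' := by rw [← hc, hc']; noncomm_ring
      _ = a * b * (a * l * a * l) * b' * a' := by rw [← hb]; noncomm_ring
      _ = a * (b * l) * a * l * (a * b' * a') := by rw [hrec]; noncomm_ring
      _ = a * l * b * a * (l * b') * a' * b := by rw [← e2, hc]; noncomm_ring
      _ = a * l * (a' * b * a) * l * a' * b := by rw [← hc', e1]; noncomm_ring
      _ = _ := by noncomm_ring

theorem commute_conjSeq_mul (h : IsReflectionFamily N r r' x) {m : ℕ} (hm : m + 1 < N) :
    Commute (r m) (conjSeq r r' x m * conjSeq r r' x (m + 1)) := by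
  have hr := h.reflection_conjSeq hm
  change r m * (conjSeq r r' x m * (r m * conjSeq r r' x m * r' m))
    = conjSeq r r' x m * (r m * conjSeq r r' x m * r' m) * r m
  have h1 := h.mul_inv m
  have h2 := h.inv_mul m
  generalize conjSeq r r' x m = l at *
  calc r m * (l * (r m * l * r' m)) = (r m * l * r m * l) * r' m := by noncomm_ring
    _ = l * r m * l * (r m * r' m) := by rw [hr]; noncomm_ring
    _ = l * (r m * l * (r' m * r m)) := by rw [h1, h2]; noncomm_ring
    _ = _ := by noncomm_ring

theorem commute_prod_of_le (h : IsReflectionFamily N r r' x) {i m : ℕ} (hm : m ≤ i) :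
    Commute (r i) (List.ofFn fun j : Fin m => conjSeq r r' x j).prod := by
  induction m with
  | zero => simp
  | succ m ih =>
    rw [prod_ofFn_succ]
    exact (ih (by omega)).mul_right (h.commute_conjSeq_of_lt (by omega))

/-- A generator on the first `m` strands commutes with the product of the first `m` elements of the
sequence: it commutes with every factor except two adjacent ones, and with their product. -/
theorem commute_prod (h : IsReflectionFamily N r r' x) {i m : ℕ} (hi : i + 1 < m) (hm : m ≤ N) :
    Commute (r i) (List.ofFn fun j : Fin m => conjSeq r r' x j).prod := by
  induction m, hi using Nat.le_induction with
  | base =>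
    rw [prod_ofFn_succ, prod_ofFn_succ, mul_assoc]
    exact (h.commute_prod_of_le le_rfl).mul_right (h.commute_conjSeq_mul (by omega))
  | succ m hi ih =>
    rw [prod_ofFn_succ]
    exact (ih (by omega)).mul_right (h.commute_conjSeq_of_add_one_lt hi (by omega))

/-- In the consequence `x · (r₀ x r₀⁻¹) = (r₀⁻¹ x r₀) · x` of the reflection equation the inner
`x` may be raised to any power. -/
theorem mul_conj_pow (h : IsReflectionFamily N r r' x) (hN : 1 < N) (k : ℕ) :
    x * (r 0 * x ^ k * r' 0) = r' 0 * x ^ k * r 0 * x := by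
  have hr := h.reflection hN
  have h1 := h.mul_inv 0
  have h2 := h.inv_mul 0
  generalize r 0 = a at *
  generalize r' 0 = a' at *
  have base : x * (a * x * a') = a' * x * a * x := by
    calc x * (a * x * a') = (a' * a) * x * a * x * a' := by rw [h2]; noncomm_ring
      _ = a' * (a * x * a * x) * a' := by noncomm_ring
      _ = a' * x * a * x * (a * a') := by rw [hr]; noncomm_ring
      _ = _ := by rw [h1, mul_one]
  rw [← conj_pow h2 h1, ← conj_pow h1 h2]
  exact SemiconjBy.pow_right (a := x) base k

theorem mul_conj_pow_conjSeq (h : IsReflectionFamily N r r' x) {m : ℕ} (hm : m + 1 < N) (j : ℕ) :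
    r m * conjSeq r r' x m * conjSeq r r' x (m + 1) ^ j
      = conjSeq r r' x m ^ j * r m * conjSeq r r' x m := by
  have hr := h.reflection_conjSeq hm
  have h1 := h.mul_inv m
  have h2 := h.inv_mul m
  change r m * conjSeq r r' x m * (r m * conjSeq r r' x m * r' m) ^ j = _
  rw [conj_pow h2 h1]
  generalize conjSeq r r' x m = l at *
  have hc : Commute (r m * l * r m) l := by
    change r m * l * r m * l = l * (r m * l * r m)
    rw [hr]; noncomm_ring
  calc r m * l * (r m * l ^ j * r' m) = (r m * l * r m) * l ^ j * r' m := by noncomm_ring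
    _ = l ^ j * r m * l * (r m * r' m) := by rw [(hc.pow_right j).eq]; noncomm_ring
    _ = _ := by rw [h1, mul_one]

end IsReflectionFamily

end Ring

/-! ### Antisymmetrizers in the Hecke algebra -/

theorem IsGeneric.sub_inv_ne_zero {K : Type*} [Field K] {q : K} (hq : IsGeneric q) :
    q - q⁻¹ ≠ 0 := by
  intro h
  refine hq.2 2 (by norm_num) ?_
  have := hq.1
  field_simp at h
  linear_combination h

theorem IsGeneric.qNumber_ne_zero {K : Type*} [Field K] {q : K} (hq : IsGeneric q) {m : ℕ}
    (hm : 1 ≤ m) : qNumber q m ≠ 0 := by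
  unfold qNumber
  refine div_ne_zero (fun h => hq.2 (2 * m) (by omega) ?_) hq.sub_inv_ne_zero
  have h0 : q ^ m ≠ 0 := pow_ne_zero _ hq.1
  rw [inv_pow] at h
  field_simp at h
  rw [mul_comm, pow_mul]
  linear_combination h

theorem IsGeneric.qNumber_one {K : Type*} [Field K] {q : K} (hq : IsGeneric q) :
    qNumber q 1 = 1 := by
  simp [qNumber, hq.sub_inv_ne_zero]

theorem IsGeneric.qNumber_succ {K : Type*} [Field K] {q : K} (hq : IsGeneric q) (m : ℕ) :
    qNumber q (m + 1) = q ^ m + q⁻¹ * qNumber q m := by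
  have h := hq.sub_inv_ne_zero
  have h0 := hq.1
  unfold qNumber
  rw [eq_comm, eq_div_iff h, add_mul, mul_assoc, div_mul_cancel₀ _ h, pow_succ, pow_succ]
  field_simp
  ring

/-- The antisymmetrizers built from a family of elements `r i` of an algebra. -/
def hAntisymm {K : Type*} [Field K] {B : Type*} [Ring B] [Algebra K B] (q : K) (r : ℕ → B) : ℕ → B
  | 0 => 1
  | 1 => 1
  | m + 2 => (qNumber q (m + 2))⁻¹ • (hAntisymm q r (m + 1) *
      (q ^ (m + 1) • (1 : B) - qNumber q (m + 1) • r m) * hAntisymm q r (m + 1))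

section Hecke

variable {K : Type*} [Field K] {B : Type*} [Ring B] [Algebra K B] {q : K} {r : ℕ → B} {N : ℕ}

theorem commute_hAntisymm {z : B} {m : ℕ} (h : ∀ i, i + 1 < m → Commute (r i) z) :
    Commute (hAntisymm q r m) z := by
  induction m with
  | zero => exact Commute.one_left _
  | succ m ih =>
    cases m with
    | zero => exact Commute.one_left _
    | succ m =>
      have h1 := ih fun i hi => h i (by omega)
      have h2 := h m (by omega)
      exact ((h1.mul_left (((Commute.one_left z).smul_left _).sub_left
        (h2.smul_left _))).mul_left h1).smul_left _

/-- The relations of the Hecke algebra on `N` strands. -/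
structure IsHeckeFamily (q : K) (N : ℕ) (r : ℕ → B) : Prop where
  sq : ∀ i, i + 1 < N → r i * r i = (q - q⁻¹) • r i + 1
  braid : ∀ i, i + 2 < N → r i * r (i + 1) * r i = r (i + 1) * r i * r (i + 1)
  far : ∀ i j, i + 2 ≤ j → Commute (r i) (r j)

/-- One step of the induction for `hAntisymm_mul`: `a` and `E` are consecutive antisymmetrizers,
`s` is the generator that links them, and `t` is the next generator. -/
theorem absorb_step {E a s t : B} {c d : K} {m : ℕ} (hq : q ≠ 0) (hd : d ≠ 0)
    (hE : E = d⁻¹ • (a * (q ^ m • (1 : B) - c • s) * a)) (hEa : E * a = E) (hEE : E * E = E)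
    (hEs : E * s = -q⁻¹ • E) (hat : Commute a t) (ht : t * t = (q - q⁻¹) • t + 1)
    (hst : s * t * s = t * s * t) :
    E * (q ^ (m + 1) • (1 : B) - d • t) * E * t
      = -q⁻¹ • (E * (q ^ (m + 1) • (1 : B) - d • t) * E) := by
  have hEta : E * t * a = E * t := by rw [mul_assoc, ← hat.eq, ← mul_assoc, hEa]
  have hEtE : d • (E * t * E) = q ^ m • (E * t) - c • (E * t * s * a) := by
    conv_lhs => rw [hE, mul_smul_comm, ← hE]
    rw [smul_smul, mul_inv_cancel₀ hd, one_smul, ← mul_assoc, ← mul_assoc, hEta, mul_sub, sub_mul]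
    simp only [mul_smul_comm, smul_mul_assoc, mul_one, hEta]
  have hu : E * (q ^ (m + 1) • (1 : B) - d • t) * E
      = q ^ (m + 1) • E - (q ^ m • (E * t) - c • (E * t * s * a)) := by
    rw [← hEtE, mul_sub, sub_mul]
    simp only [mul_smul_comm, smul_mul_assoc, mul_one, hEE]
  have h1 : E * t * t = (q - q⁻¹) • (E * t) + E := by
    rw [mul_assoc, ht, mul_add, mul_smul_comm, mul_one]
  have h2 : E * t * s * a * t = -q⁻¹ • (E * t * s * a) := by
    calc E * t * s * a * t = E * (t * s * t) * a := by
          rw [mul_assoc _ a t, hat.eq]; noncomm_ring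
      _ = E * s * t * s * a := by rw [← hst]; noncomm_ring
      _ = _ := by rw [hEs]; simp only [smul_mul_assoc]
  rw [hu]
  simp only [sub_mul, smul_mul_assoc, h1, h2]
  have hqq : q ^ m = q⁻¹ * q ^ (m + 1) := by rw [pow_succ]; field_simp
  rw [hqq]
  match_scalars <;> field_simp
  ring

/-- The antisymmetrizer on `m + 1` strands is idempotent and absorbs each generator on these strands
with the factor `-q⁻¹`; the two facts are proved by a simultaneous induction. -/
theorem IsHeckeFamily.hAntisymm_mul_aux (hq : IsGeneric q) (h : IsHeckeFamily q N r) {m : ℕ}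
    (hm : m + 1 ≤ N) :
    hAntisymm q r (m + 1) * hAntisymm q r (m + 1) = hAntisymm q r (m + 1) ∧
      ∀ i, i + 1 < m + 1 → hAntisymm q r (m + 1) * r i = -q⁻¹ • hAntisymm q r (m + 1) := by
  induction m using Nat.strong_induction_on with
  | _ m ih =>
    cases m with
    | zero => exact ⟨one_mul _, fun i hi => by omega⟩
    | succ m =>
      obtain ⟨hEE, hEr⟩ := ih m (by omega) (by omega)
      have hdef : hAntisymm q r (m + 2) = (qNumber q (m + 2))⁻¹ • (hAntisymm q r (m + 1) *
        (q ^ (m + 1) • (1 : B) - qNumber q (m + 1) • r m) * hAntisymm q r (m + 1)) := rfl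
      have habs : ∀ i, i + 1 < m + 2 →
          hAntisymm q r (m + 2) * r i = -q⁻¹ • hAntisymm q r (m + 2) := by
        intro i hi
        rcases Nat.lt_or_ge (i + 1) (m + 1) with h1 | h1
        · rw [hdef, smul_mul_assoc, mul_assoc _ _ (r i), hEr i h1, mul_smul_comm, smul_comm]
        · obtain rfl : i = m := by omega
          cases i with
          | zero =>
            have h2 := h.sq 0 (by omega)
            rw [hdef]
            simp only [hAntisymm, one_mul, mul_one, smul_mul_assoc, sub_mul, h2,
              hq.qNumber_one, one_smul, zero_add, pow_one]
            rw [smul_comm]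
            congr 1
            have := hq.1
            match_scalars <;> field_simp
            all_goals ring
          | succ m =>
            rw [hdef, smul_mul_assoc, smul_comm]
            congr 1
            obtain ⟨haa, -⟩ := ih m (by omega) (by omega)
            refine absorb_step hq.1 (hq.qNumber_ne_zero (by omega)) rfl ?_ hEE
              (hEr m (by omega)) ?_ (h.sq _ (by omega)) (h.braid m (by omega))
            · change (_ • _) * _ = _ • _
              rw [smul_mul_assoc, mul_assoc _ _ (hAntisymm q r (m + 1)), haa]
            · exact commute_hAntisymm fun i hi => h.far _ _ (by omega)
      refine ⟨?_, habs⟩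
      have hAE : hAntisymm q r (m + 2) * hAntisymm q r (m + 1) = hAntisymm q r (m + 2) := by
        rw [hdef, smul_mul_assoc, mul_assoc _ _ (hAntisymm q r (m + 1)), hEE]
      have hne := hq.qNumber_ne_zero (m := m + 2) (by omega)
      conv_lhs => arg 2; rw [hdef]
      rw [mul_smul_comm]
      rw [← mul_assoc, ← mul_assoc, hAE, mul_sub, mul_smul_comm, mul_smul_comm, mul_one,
        habs m (by omega), sub_mul, smul_mul_assoc, smul_mul_assoc, smul_mul_assoc, hAE,
        smul_smul, ← sub_smul, smul_smul]
      have : (qNumber q (m + 2))⁻¹ * (q ^ (m + 1) - qNumber q (m + 1) * -q⁻¹) = 1 := by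
        rw [show q ^ (m + 1) - qNumber q (m + 1) * -q⁻¹ = qNumber q (m + 1 + 1) by
          rw [hq.qNumber_succ (m + 1)]; ring]
        exact inv_mul_cancel₀ hne
      rw [this, one_smul]

theorem IsHeckeFamily.hAntisymm_mul_self (hq : IsGeneric q) (h : IsHeckeFamily q N r) {m : ℕ}
    (hm : m + 1 ≤ N) :
    hAntisymm q r (m + 1) * hAntisymm q r (m + 1) = hAntisymm q r (m + 1) :=
  (h.hAntisymm_mul_aux hq hm).1

end Hecke

/-! ### Operators on some of the tensor factors -/

section Ampl

set_option linter.unusedSectionVars false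

variable {ι α β : Type*} [Fintype ι] [Fintype α] [Fintype β] [DecidableEq ι] [DecidableEq α]
  [DecidableEq β] {A : Type*} [Ring A]

/-- `X ↦ X ⊗ I`, where the identification `e` of the index set with a product `α × β` says on
which tensor factors `X` acts. -/
def ampl (e : ι ≃ α × β) : Matrix α α A →+* Matrix ι ι A where
  toFun X := Matrix.of fun f g => if (e f).2 = (e g).2 then X (e f).1 (e g).1 else 0
  map_one' := by
    ext f g
    simp only [Matrix.of_apply, Matrix.one_apply, ← ite_and, ← Prod.ext_iff, and_comm,
      e.apply_eq_iff_eq]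
  map_mul' X Y := by
    ext f g
    refine Eq.symm ((Matrix.mul_apply ..).trans ?_)
    rw [← e.symm.sum_comp, Fintype.sum_prod_type]
    by_cases h : (e f).2 = (e g).2 <;> simp [Matrix.mul_apply, h]
  map_zero' := by ext f g; simp
  map_add' X Y := by ext f g; by_cases h : (e f).2 = (e g).2 <;> simp [h]

theorem ampl_apply (e : ι ≃ α × β) (X : Matrix α α A) (f g : ι) :
    ampl e X f g = if (e f).2 = (e g).2 then X (e f).1 (e g).1 else 0 := rfl

theorem ampl_map {A' : Type*} [Ring A'] (φ : A →+* A') (e : ι ≃ α × β) (X : Matrix α α A) :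
    (ampl e X).map φ = ampl e (X.map φ) := by
  ext f g
  simp only [Matrix.map_apply, ampl_apply]
  split_ifs <;> simp

theorem ampl_smul {K : Type*} [Field K] [Algebra K A] (c : K) (e : ι ≃ α × β) (X : Matrix α α A) :
    ampl e (c • X) = c • ampl e X := by
  ext f g
  simp only [Matrix.smul_apply, ampl_apply]
  split_ifs <;> simp

theorem ampl_mul_apply (e : ι ≃ α × β) (X : Matrix α α A) (Z : Matrix ι ι A) (f g : ι) :
    (ampl e X * Z) f g = ∑ a, X (e f).1 a * Z (e.symm (a, (e f).2)) g := by
  rw [Matrix.mul_apply, ← e.symm.sum_comp, Fintype.sum_prod_type]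
  simp [ampl_apply]

theorem mul_ampl_apply (e : ι ≃ α × β) (X : Matrix α α A) (Z : Matrix ι ι A) (f g : ι) :
    (Z * ampl e X) f g = ∑ a, Z f (e.symm (a, (e g).2)) * X a (e g).1 := by
  rw [Matrix.mul_apply, ← e.symm.sum_comp, Fintype.sum_prod_type]
  simp [ampl_apply]

theorem ampl_mul_ampl_swap_apply (e : ι ≃ α × β) (X : Matrix α α A) (Y : Matrix β β A) (f g : ι) :
    (ampl e X * ampl (e.trans (Equiv.prodComm α β)) Y) f g
      = X (e f).1 (e g).1 * Y (e f).2 (e g).2 := by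
  simp [ampl_mul_apply, ampl_apply]

/-- Operators on complementary tensor factors commute when their entries do. -/
theorem commute_ampl_swap (e : ι ≃ α × β) (X : Matrix α α A) (Y : Matrix β β A)
    (h : ∀ a a' b b', Commute (X a a') (Y b b')) :
    Commute (ampl e X) (ampl (e.trans (Equiv.prodComm α β)) Y) := by
  change _ = _
  ext f g
  rw [ampl_mul_ampl_swap_apply, mul_ampl_apply]
  simp [ampl_apply, (h _ _ _ _).eq]

end Ampl

section Sites

variable {n : ℕ} {A : Type*} [Ring A]

/-- Splits off the last tensor factor. -/
def splitLast (n N : ℕ) : (Fin (N + 1) → Fin n) ≃ (Fin N → Fin n) × Fin n where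
  toFun f := (Fin.init f, f (Fin.last N))
  invFun x := Fin.snoc x.1 x.2
  left_inv f := by simp
  right_inv x := by simp

/-- Splits off the first tensor factor. -/
def splitFirst (n N : ℕ) : (Fin (N + 1) → Fin n) ≃ (Fin N → Fin n) × Fin n where
  toFun f := (Fin.tail f, f 0)
  invFun x := Fin.cons x.2 x.1
  left_inv f := by simp
  right_inv x := by simp

/-- Splits off the first two tensor factors. -/
def splitFirstPair (n N : ℕ) : (Fin (N + 2) → Fin n) ≃ (Fin n × Fin n) × (Fin N → Fin n) where
  toFun f := ((f 0, f 1), Fin.tail (Fin.tail f))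
  invFun x := Fin.cons x.1.1 (Fin.cons x.1.2 x.2)
  left_inv f := by
    funext i
    refine Fin.cases rfl (fun i => ?_) i
    refine Fin.cases rfl (fun i => ?_) i
    rfl
  right_inv x := by
    refine Prod.ext (Prod.ext rfl rfl) ?_
    simp

/-- Splits off the last two tensor factors. -/
def splitLastPair (n N : ℕ) : (Fin (N + 2) → Fin n) ≃ (Fin n × Fin n) × (Fin N → Fin n) where
  toFun f := ((f (Fin.last N).castSucc, f (Fin.last (N + 1))), Fin.init (Fin.init f))
  invFun x := Fin.snoc (Fin.snoc x.2 x.1.1 : Fin (N + 1) → Fin n) x.1.2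
  left_inv f := by
    have : Fin.snoc (Fin.init (Fin.init f)) (f (Fin.last N).castSucc) = Fin.init f :=
      Fin.snoc_init_self (Fin.init f)
    simp only [this]
    exact Fin.snoc_init_self f
  right_inv x := by simp

/-- `X ↦ X ⊗ I` from `N` to `N + 1` sites. -/
def addLast (n N : ℕ) (A : Type*) [Ring A] :
    Matrix (Fin N → Fin n) (Fin N → Fin n) A →+*
      Matrix (Fin (N + 1) → Fin n) (Fin (N + 1) → Fin n) A :=
  ampl (splitLast n N)

/-- `X ↦ I ⊗ X` from `N` to `N + 1` sites. -/
def addFirst (n N : ℕ) (A : Type*) [Ring A] :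
    Matrix (Fin N → Fin n) (Fin N → Fin n) A →+*
      Matrix (Fin (N + 1) → Fin n) (Fin (N + 1) → Fin n) A :=
  ampl (splitFirst n N)

theorem addLast_apply {N : ℕ} (X : Matrix (Fin N → Fin n) (Fin N → Fin n) A)
    (f g : Fin N → Fin n) (a b : Fin n) :
    addLast n N A X (Fin.snoc f a) (Fin.snoc g b) = if a = b then X f g else 0 := by
  simp [addLast, ampl_apply, splitLast]

theorem atFirst_succ (L : Matrix (Fin n) (Fin n) A) (N : ℕ) :
    atFirst L (N + 1) = ampl ((splitFirst n N).trans (Equiv.prodComm _ _)) L := by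
  ext f g
  simp only [atFirst, Nat.succ_pos, dif_pos, Matrix.of_apply, ampl_apply]
  refine if_congr ?_ rfl rfl
  simp only [splitFirst, Equiv.trans_apply, Equiv.coe_fn_mk, Equiv.prodComm_apply, Prod.swap,
    funext_iff, Fin.tail]
  constructor
  · intro h j
    exact h j.succ (by simp)
  · intro h j hj
    obtain ⟨i, rfl⟩ := Fin.exists_succ_eq.2 (fun h0 => hj (by simp [h0]) : j ≠ 0)
    exact h i

theorem atFirst_succ_succ (L : Matrix (Fin n) (Fin n) A) (N : ℕ) :
    atFirst L (N + 2) = addLast n (N + 1) A (atFirst L (N + 1)) := by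
  ext f g
  simp only [atFirst, Nat.succ_pos, dif_pos, addLast, ampl_apply, splitLast, Equiv.coe_fn_mk,
    Matrix.of_apply]
  rw [← ite_and]
  refine if_congr ?_ rfl rfl
  constructor
  · intro h
    exact ⟨h _ (by simp), fun j hj => h j.castSucc hj⟩
  · rintro ⟨h1, h2⟩ j
    exact Fin.lastCases (fun _ => h1) (fun j hj => h2 j hj) j

variable {K : Type*} [Field K] (X Y : Matrix (Fin n × Fin n) (Fin n × Fin n) K)

theorem atPair_zero (N : ℕ) : atPair X (N + 2) 0 = ampl (splitFirstPair n N) X := by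
  ext f g
  simp only [atPair, zero_add, show 1 < N + 2 by omega, dif_pos, Matrix.of_apply, ampl_apply]
  refine if_congr ?_ rfl rfl
  simp only [splitFirstPair, Equiv.coe_fn_mk, funext_iff, Fin.tail]
  constructor
  · intro h j
    exact h j.succ.succ (by simp) (by simp)
  · intro h j hj hj'
    obtain ⟨i, rfl⟩ := Fin.exists_succ_eq.2 (fun h0 => hj (by simp [h0]) : j ≠ 0)
    obtain ⟨k, rfl⟩ := Fin.exists_succ_eq.2 (fun h0 => hj' (by simp [h0]) : i ≠ 0)
    exact h k

theorem atPair_last (N : ℕ) : atPair X (N + 2) N = ampl (splitLastPair n N) X := by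
  ext f g
  simp only [atPair, show N + 1 < N + 2 by omega, dif_pos, Matrix.of_apply, ampl_apply]
  refine if_congr ?_ rfl rfl
  simp only [splitLastPair, Equiv.coe_fn_mk, funext_iff, Fin.init]
  constructor
  · intro h j
    exact h j.castSucc.castSucc (by simpa using j.2.ne) (by simpa using by omega)
  · intro h j hj hj'
    have := h ⟨j, by have := j.2; omega⟩
    exact this

theorem atPair_succ (N i : ℕ) : atPair X (N + 1) (i + 1) = addFirst n N K (atPair X N i) := by
  by_cases hi : i + 1 < N
  · ext f g
    simp only [atPair, addFirst, show i + 1 + 1 < N + 1 by omega, hi, dif_pos, Matrix.of_apply,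
      ampl_apply, splitFirst, Equiv.coe_fn_mk]
    rw [← ite_and]
    refine if_congr ?_ rfl rfl
    constructor
    · intro h
      exact ⟨h 0 (by simp) (by simp), fun j h1 h2 => h j.succ (by simpa using h1)
        (by simpa using h2)⟩
    · rintro ⟨h1, h2⟩ j
      exact Fin.cases (fun _ _ => h1) (fun j hj hj' => h2 j (by simpa using hj)
        (by simpa using hj')) j
  · simp [atPair, hi]

theorem atPair_addLast {N i : ℕ} (hi : i + 1 < N) :
    atPair X (N + 1) i = addLast n N K (atPair X N i) := by
  ext f g
  simp only [atPair, addLast, show i + 1 < N + 1 by omega, hi, dif_pos, Matrix.of_apply,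
      ampl_apply, splitLast, Equiv.coe_fn_mk]
  rw [← ite_and]
  refine if_congr ?_ rfl rfl
  constructor
  · intro h
    exact ⟨h _ (by simp; omega) (by simp; omega), fun j h1 h2 => h j.castSucc h1 h2⟩
  · rintro ⟨h1, h2⟩ j
    exact Fin.lastCases (fun _ _ => h1) (fun j hj hj' => h2 j hj hj') j

theorem atPair_mul (N i : ℕ) : atPair (X * Y) N i = atPair X N i * atPair Y N i := by
  induction i generalizing N with
  | zero =>
    rcases N with _ | _ | N
    · simp [atPair]
    · simp [atPair]
    · simp only [atPair_zero, map_mul]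
  | succ i ih =>
    cases N with
    | zero => simp [atPair]
    | succ N => simp only [atPair_succ, ih, map_mul]

theorem atPair_one (N i : ℕ) :
    atPair (1 : Matrix (Fin n × Fin n) (Fin n × Fin n) K) N i = 1 := by
  induction i generalizing N with
  | zero =>
    rcases N with _ | _ | N
    · simp [atPair]
    · simp [atPair]
    · simp only [atPair_zero, map_one]
  | succ i ih =>
    cases N with
    | zero => simp [atPair]
    | succ N => simp only [atPair_succ, ih, map_one]

theorem atPair_add {N i : ℕ} (hi : i + 1 < N) :
    atPair (X + Y) N i = atPair X N i + atPair Y N i := by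
  induction i generalizing N with
  | zero =>
    obtain ⟨N, rfl⟩ : ∃ M, N = M + 2 := ⟨N - 2, by omega⟩
    simp only [atPair_zero, map_add]
  | succ i ih =>
    obtain ⟨N, rfl⟩ : ∃ M, N = M + 1 := ⟨N - 1, by omega⟩
    rw [atPair_succ, atPair_succ, atPair_succ, ih (by omega), map_add]

theorem atPair_smul (c : K) {N i : ℕ} (hi : i + 1 < N) :
    atPair (c • X) N i = c • atPair X N i := by
  induction i generalizing N with
  | zero =>
    obtain ⟨N, rfl⟩ : ∃ M, N = M + 2 := ⟨N - 2, by omega⟩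
    simp only [atPair_zero, ampl_smul]
  | succ i ih =>
    obtain ⟨N, rfl⟩ : ∃ M, N = M + 1 := ⟨N - 1, by omega⟩
    rw [atPair_succ, atPair_succ, ih (by omega), addFirst, ampl_smul]

theorem commute_atPair (N : ℕ) {i j : ℕ} (hij : i + 2 ≤ j) :
    Commute (atPair X N i) (atPair Y N j) := by
  induction i generalizing N j with
  | zero =>
    rcases N with _ | _ | N
    · simp [atPair]
    · simp [atPair]
    · obtain ⟨j, rfl⟩ : ∃ k, j = k + 2 := ⟨j - 2, by omega⟩
      rw [atPair_zero, atPair_succ, atPair_succ]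
      have : addFirst n (N + 1) K (addFirst n N K (atPair Y N j))
          = ampl ((splitFirstPair n N).trans (Equiv.prodComm _ _)) (atPair Y N j) := by
        ext f g
        simp only [addFirst, ampl_apply, splitFirst, splitFirstPair, Equiv.coe_fn_mk,
          Equiv.trans_apply, Equiv.prodComm_apply, Prod.swap, Prod.ext_iff, ← ite_and]
        rfl
      rw [this]
      exact commute_ampl_swap _ _ _ fun _ _ _ _ => mul_comm _ _
  | succ i ih =>
    obtain ⟨j, rfl⟩ : ∃ k, j = k + 1 := ⟨j - 1, by omega⟩
    cases N with
    | zero => simp [atPair]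
    | succ N =>
      rw [atPair_succ, atPair_succ]
      exact (ih N (by omega)).map _

theorem commute_atPair_atFirst [Algebra K A] (L : Matrix (Fin n) (Fin n) A) (N i : ℕ) :
    Commute ((atPair X N (i + 1)).map (algebraMap K A)) (atFirst L N) := by
  cases N with
  | zero => simp [atFirst]
  | succ N =>
    rw [atPair_succ, atFirst_succ, addFirst, ampl_map]
    exact commute_ampl_swap _ _ _ fun _ _ _ _ => Algebra.commutes _ _

theorem atPair_braid {R : Matrix (Fin n × Fin n) (Fin n × Fin n) K}
    (h : atPair R 3 0 * atPair R 3 1 * atPair R 3 0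
      = atPair R 3 1 * atPair R 3 0 * atPair R 3 1) {N i : ℕ} (hi : i + 2 < N) :
    atPair R N i * atPair R N (i + 1) * atPair R N i
      = atPair R N (i + 1) * atPair R N i * atPair R N (i + 1) := by
  induction i generalizing N with
  | zero =>
    induction N, hi using Nat.le_induction with
    | base => exact h
    | succ N hN ih =>
      rw [atPair_addLast R (by omega), atPair_addLast R (by omega)]
      simp only [← map_mul, ih]
  | succ i ih =>
    obtain ⟨N, rfl⟩ : ∃ M, N = M + 1 := ⟨N - 1, by omega⟩
    simp only [atPair_succ, ← map_mul]
    rw [ih (by omega)]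

end Sites

/-! ### Partial `R`-traces -/

section LastTrace

variable {n : ℕ} {K : Type*} [Field K] {A : Type*} [Ring A] [Algebra K A]

theorem sum_snoc {M : Type*} [AddCommMonoid M] (N : ℕ) (F : (Fin (N + 1) → Fin n) → M) :
    ∑ f, F f = ∑ f : Fin N → Fin n, ∑ a : Fin n, F (Fin.snoc f a) := by
  rw [← (splitLast n N).symm.sum_comp, Fintype.sum_prod_type]
  rfl

/-- The partial trace over the last site, weighted by the matrix `C`. -/
def lastTrace (C : Matrix (Fin n) (Fin n) K) (N : ℕ)
    (X : Matrix (Fin (N + 1) → Fin n) (Fin (N + 1) → Fin n) A) :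
    Matrix (Fin N → Fin n) (Fin N → Fin n) A :=
  Matrix.of fun f g => ∑ a, ∑ b, C a b • X (Fin.snoc f b) (Fin.snoc g a)

variable (C : Matrix (Fin n) (Fin n) K)

theorem lastTrace_addLast_mul {N : ℕ} (X : Matrix (Fin N → Fin n) (Fin N → Fin n) A)
    (Y : Matrix (Fin (N + 1) → Fin n) (Fin (N + 1) → Fin n) A) :
    lastTrace C N (addLast n N A X * Y) = X * lastTrace C N Y := by
  ext f g
  simp only [lastTrace, Matrix.of_apply, Matrix.mul_apply, sum_snoc, addLast_apply, ite_mul,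
    zero_mul, Finset.sum_ite_eq, Finset.mem_univ, if_true, Finset.smul_sum, Finset.mul_sum,
    mul_smul_comm]
  rw [Finset.sum_comm_cycle]

theorem lastTrace_mul_addLast {N : ℕ} (X : Matrix (Fin N → Fin n) (Fin N → Fin n) A)
    (Y : Matrix (Fin (N + 1) → Fin n) (Fin (N + 1) → Fin n) A) :
    lastTrace C N (Y * addLast n N A X) = lastTrace C N Y * X := by
  ext f g
  simp only [lastTrace, Matrix.of_apply, Matrix.mul_apply, sum_snoc, addLast_apply, mul_ite,
    mul_zero, Finset.sum_ite_eq', Finset.mem_univ, if_true, Finset.smul_sum, Finset.sum_mul,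
    smul_mul_assoc]
  rw [Finset.sum_comm_cycle]

theorem rTraceSites_succ (Ψ : Matrix (Fin n × Fin n) (Fin n × Fin n) K) (N : ℕ)
    (X : Matrix (Fin (N + 1) → Fin n) (Fin (N + 1) → Fin n) A) :
    rTraceSites Ψ (N + 1) X = rTraceSites Ψ N (lastTrace (cMatrix Ψ) N X) := by
  simp only [rTraceSites, lastTrace, Matrix.trace, Matrix.diag, Matrix.mul_apply, Matrix.of_apply,
    sum_snoc, Fin.prod_univ_castSucc, Fin.snoc_castSucc, Fin.snoc_last, Finset.mul_sum, map_mul]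
  refine Finset.sum_congr rfl fun f _ => ?_
  rw [Finset.sum_comm]
  refine Finset.sum_congr rfl fun g _ => Finset.sum_congr rfl fun a _ =>
    Finset.sum_congr rfl fun b _ => ?_
  rw [Algebra.smul_def, mul_assoc]

theorem pairLast_apply (U : Matrix (Fin n × Fin n) (Fin n × Fin n) K) {N : ℕ} (f g : Fin N → Fin n)
    (a b c d : Fin n) :
    (atPair U (N + 2) N).map (algebraMap K A) (Fin.snoc (Fin.snoc f a : Fin (N + 1) → Fin n) b)
      (Fin.snoc (Fin.snoc g c : Fin (N + 1) → Fin n) d)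
      = if f = g then algebraMap K A (U (a, b) (c, d)) else 0 := by
  rw [atPair_last, ampl_map]
  simp [ampl_apply, splitLastPair]

/-- The coefficients of the map `x ↦ Tr_{(2)} (C₂ U₁₂ x₁ U'₁₂)` on matrices `x`. -/
def conjCoeff (U U' : Matrix (Fin n × Fin n) (Fin n × Fin n) K) (i j c d : Fin n) : K :=
  ∑ a, ∑ b, ∑ e, C a b * U (i, b) (c, e) * U' (d, e) (j, a)

theorem lastTrace_conj_apply (U U' : Matrix (Fin n × Fin n) (Fin n × Fin n) K) {N : ℕ}
    (X : Matrix (Fin (N + 1) → Fin n) (Fin (N + 1) → Fin n) A) (f g : Fin N → Fin n)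
    (i j : Fin n) :
    lastTrace C (N + 1) ((atPair U (N + 2) N).map (algebraMap K A) * addLast n (N + 1) A X *
      (atPair U' (N + 2) N).map (algebraMap K A)) (Fin.snoc f i) (Fin.snoc g j)
      = ∑ c, ∑ d, conjCoeff C U U' i j c d • X (Fin.snoc f c) (Fin.snoc g d) := by
  have key : ∀ a b, ((atPair U (N + 2) N).map (algebraMap K A) * addLast n (N + 1) A X *
      (atPair U' (N + 2) N).map (algebraMap K A)) (Fin.snoc (Fin.snoc f i : Fin (N + 1) → Fin n) b)
      (Fin.snoc (Fin.snoc g j : Fin (N + 1) → Fin n) a)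
      = ∑ c, ∑ d, ∑ e, (U (i, b) (c, e) * U' (d, e) (j, a)) •
          X (Fin.snoc f c) (Fin.snoc g d) := by
    intro a b
    simp only [Matrix.mul_apply, sum_snoc, pairLast_apply, addLast_apply, mul_ite, ite_mul,
      zero_mul, mul_zero, Finset.sum_ite_irrel, Finset.sum_const_zero, Finset.sum_ite_eq,
      Finset.sum_ite_eq', Finset.mem_univ, if_true, Finset.sum_mul]
    rw [Finset.sum_comm_cycle]
    refine Finset.sum_congr rfl fun c _ => Finset.sum_congr rfl fun d _ =>
      Finset.sum_congr rfl fun e _ => ?_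
    rw [mul_assoc, ← Algebra.commutes, ← mul_assoc, ← map_mul, Algebra.smul_def]
  simp only [lastTrace, Matrix.of_apply, key, conjCoeff, Finset.sum_smul, Finset.smul_sum,
    smul_smul]
  rw [Finset.sum_comm_cycle]
  refine Finset.sum_congr rfl fun c _ => ?_
  rw [Finset.sum_comm_cycle]
  simp only [mul_assoc]

end LastTrace

/-! ### The matrix `C` of a skew-invertible Hecke symmetry -/

section Skew

variable {n : ℕ} {K : Type*} [Field K] {q : K} {p : ℕ}
  {R Ψ : Matrix (Fin n × Fin n) (Fin n × Fin n) K}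

theorem sum_comm_three_two {ι M : Type*} [Fintype ι] [AddCommMonoid M] (F : ι → ι → ι → ι → ι → M) :
    ∑ a, ∑ b, ∑ e, ∑ c, ∑ d, F a b e c d = ∑ c, ∑ d, ∑ a, ∑ b, ∑ e, F a b e c d := by
  have h : ∀ a b, ∑ e, ∑ c, ∑ d, F a b e c d = ∑ c, ∑ d, ∑ e, F a b e c d :=
    fun a b => Finset.sum_comm_cycle.symm
  simp only [h]
  rw [Finset.sum_comm_cycle]
  refine Finset.sum_congr rfl fun c _ => ?_
  rw [Finset.sum_comm_cycle]

theorem IsEvenHeckeSymmetry.mul_self (hR : IsEvenHeckeSymmetry q p R) (hq : q ≠ 0) :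
    R * R = (q - q⁻¹) • R + 1 := by
  have h := hR.hecke
  rw [sub_mul, mul_add, mul_add] at h
  simp only [mul_smul_comm, smul_mul_assoc, mul_one, one_mul, smul_smul, inv_mul_cancel₀ hq,
    one_smul] at h
  rw [sub_smul, ← sub_eq_zero, ← h]
  abel

theorem IsEvenHeckeSymmetry.mul_inv (hR : IsEvenHeckeSymmetry q p R) (hq : q ≠ 0) :
    R * R⁻¹ = 1 := by
  have h : R * (R - (q - q⁻¹) • 1) = 1 := by
    rw [mul_sub, hR.mul_self hq]; simp
  rw [Matrix.inv_eq_right_inv h, h]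

theorem IsEvenHeckeSymmetry.inv_mul (hR : IsEvenHeckeSymmetry q p R) (hq : q ≠ 0) :
    R⁻¹ * R = 1 := mul_eq_one_comm.1 (hR.mul_inv hq)

/-- `Tr_{(2)} (C₂ R₁₂) = I₁`. -/
theorem IsSkewInverse.sum_cMatrix_mul (hΨ : IsSkewInverse R Ψ) (i j : Fin n) :
    ∑ a, ∑ b, cMatrix Ψ a b * R (i, b) (j, a) = if i = j then 1 else 0 := by
  have h : ∀ k, ∑ a, ∑ b, R (i, a) (j, b) * Ψ (b, k) (a, k) = if i = k ∧ k = j then 1 else 0 :=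
    fun k => hΨ.right i j k k
  simp only [cMatrix, Matrix.of_apply, Finset.sum_mul]
  calc ∑ a, ∑ b, ∑ k, Ψ (a, k) (b, k) * R (i, b) (j, a)
      = ∑ k, ∑ a, ∑ b, R (i, a) (j, b) * Ψ (b, k) (a, k) := by
        rw [Finset.sum_comm_cycle]
        refine Finset.sum_congr rfl fun k _ => ?_
        rw [Finset.sum_comm]
        simp only [mul_comm]
    _ = ∑ k, if i = k then (if i = j then (1 : K) else 0) else 0 := by
        refine Finset.sum_congr rfl fun k _ => ?_
        rw [h, ite_and]
        by_cases hk : i = k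
        · subst hk; simp
        · simp [hk]
    _ = _ := by simp

theorem lastTrace_atPair (hΨ : IsSkewInverse R Ψ) {A : Type*} [Ring A] [Algebra K A] (N : ℕ) :
    lastTrace (cMatrix Ψ) (N + 1) ((atPair R (N + 2) N).map (algebraMap K A)) = 1 := by
  ext f g
  rw [← Fin.snoc_init_self f, ← Fin.snoc_init_self g]
  generalize Fin.init f = f', f (Fin.last N) = i, Fin.init g = g', g (Fin.last N) = j
  simp only [lastTrace, Matrix.of_apply, pairLast_apply, Matrix.one_apply, Fin.snoc_inj]
  by_cases hfg : f' = g'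
  · have h := congrArg (algebraMap K A) (hΨ.sum_cMatrix_mul i j)
    simp only [map_sum, map_mul] at h
    simp only [hfg, if_true, Algebra.smul_def, h, true_and]
    split_ifs <;> simp
  · simp [hfg]

/-- A conjugation by `U` that is compatible with the braid relation in the sense of `hU` turns the
partial trace over the second site into the trace over the first one. The slices of `R` span all
matrices because `R` has a left skew inverse, so it is enough to check this on `R`. -/
theorem IsSkewInverse.conjCoeff_eq (hΨ : IsSkewInverse R Ψ)
    {U U' V V' : Matrix (Fin n × Fin n) (Fin n × Fin n) K} (hV : V' * V = 1)
    (hU : atPair U 3 1 * atPair R 3 0 * atPair U' 3 1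
      = atPair V' 3 0 * atPair R 3 1 * atPair V 3 0) (i j c d : Fin n) :
    conjCoeff (cMatrix Ψ) U U' i j c d = if i = j then cMatrix Ψ d c else 0 := by
  have hid : ∀ X : Matrix (Fin 3 → Fin n) (Fin 3 → Fin n) K, X.map (algebraMap K K) = X :=
    fun X => by ext; simp
  have h1 : lastTrace (cMatrix Ψ) 2
      (atPair U 3 1 * addLast n 2 K (atPair R 2 0) * atPair U' 3 1) = 1 := by
    rw [← atPair_addLast R (by omega), hU, atPair_addLast V' (by omega),
      atPair_addLast V (by omega), lastTrace_mul_addLast, lastTrace_addLast_mul]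
    have := lastTrace_atPair hΨ (A := K) 1
    rw [hid] at this
    rw [this, mul_one, ← atPair_mul, hV, atPair_one]
  -- the difference of the two sides is annihilated by pairing with all slices of `R`
  have h2 : ∀ u v, ∑ c, ∑ d, (conjCoeff (cMatrix Ψ) U U' i j c d
      - if i = j then cMatrix Ψ d c else 0) * R (u, c) (v, d) = 0 := by
    intro u v
    have h3 := lastTrace_conj_apply (A := K) (cMatrix Ψ) U U' (atPair R 2 0)
      (fun _ : Fin 1 => u) (fun _ => v) i j
    rw [hid, hid, h1] at h3
    have h4 : ∀ c d, atPair R 2 0 (Fin.snoc (fun _ : Fin 1 => u) c : Fin 2 → Fin n)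
        (Fin.snoc (fun _ : Fin 1 => v) d : Fin 2 → Fin n) = R (u, c) (v, d) := by
      intro c d
      rw [atPair_zero, ampl_apply, if_pos (Subsingleton.elim _ _)]
      rfl
    simp only [h4, smul_eq_mul] at h3
    simp only [sub_mul, Finset.sum_sub_distrib, ← h3]
    simp only [Matrix.one_apply, Fin.snoc_inj]
    by_cases hij : i = j
    · simp only [hij, if_true, and_true]
      rw [Finset.sum_comm, hΨ.sum_cMatrix_mul u v]
      simp [funext_iff]
    · simp [hij]
  have h5 : ∑ u, ∑ v, Ψ (d, v) (c, u) * ∑ c, ∑ d, (conjCoeff (cMatrix Ψ) U U' i j c d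
      - if i = j then cMatrix Ψ d c else 0) * R (u, c) (v, d) = 0 := by
    simp only [h2, mul_zero, Finset.sum_const_zero]
  generalize hD : (fun c d => conjCoeff (cMatrix Ψ) U U' i j c d
      - if i = j then cMatrix Ψ d c else 0) = D at h5
  have hD' : ∀ c d, conjCoeff (cMatrix Ψ) U U' i j c d
      - (if i = j then cMatrix Ψ d c else 0) = D c d := fun c d => by rw [← hD]
  simp only [hD'] at h5
  rw [← sub_eq_zero, hD', ← h5]
  calc D c d = ∑ c', ∑ d', D c' d' * if d = d' ∧ c' = c then 1 else 0 := by
        simp [ite_and]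
    _ = ∑ c', ∑ d', D c' d' * ∑ v, ∑ u, Ψ (d, v) (c, u) * R (u, c') (v, d') := by
        simp only [hΨ.left]
    _ = _ := by
        simp only [Finset.mul_sum]
        rw [Finset.sum_comm_cycle, Finset.sum_comm (s := Finset.univ (α := Fin n))
          (f := fun u v => ∑ c', ∑ d', Ψ (d, v) (c, u) * (D c' d' * R (u, c') (v, d')))]
        refine Finset.sum_congr rfl fun v _ => ?_
        rw [Finset.sum_comm_cycle]
        simp only [mul_left_comm]

theorem conj_eq_conj_of_braid {B : Type*} [Ring B] {a a' b b' : B} (ha : a' * a = 1)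
    (hb : b * b' = 1) (h : a * b * a = b * a * b) : b * a * b' = a' * b * a := by
  calc b * a * b' = (a' * a) * b * a * b' := by rw [ha, one_mul]
    _ = a' * (a * b * a) * b' := by noncomm_ring
    _ = a' * b * a * (b * b') := by rw [h]; noncomm_ring
    _ = _ := by rw [hb, mul_one]

theorem IsEvenHeckeSymmetry.conjCoeff_eq (hR : IsEvenHeckeSymmetry q p R) (hq : q ≠ 0)
    (hΨ : IsSkewInverse R Ψ) (i j c d : Fin n) :
    conjCoeff (cMatrix Ψ) R R⁻¹ i j c d = if i = j then cMatrix Ψ d c else 0 := by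
  refine hΨ.conjCoeff_eq (hR.inv_mul hq) ?_ i j c d
  refine conj_eq_conj_of_braid ?_ ?_ hR.yang_baxter <;>
    rw [← atPair_mul]
  · rw [hR.inv_mul hq, atPair_one]
  · rw [hR.mul_inv hq, atPair_one]

theorem IsEvenHeckeSymmetry.conjCoeff_inv_eq (hR : IsEvenHeckeSymmetry q p R) (hq : q ≠ 0)
    (hΨ : IsSkewInverse R Ψ) (i j c d : Fin n) :
    conjCoeff (cMatrix Ψ) R⁻¹ R i j c d = if i = j then cMatrix Ψ d c else 0 := by
  refine hΨ.conjCoeff_eq (hR.mul_inv hq) ?_ i j c d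
  refine (conj_eq_conj_of_braid ?_ ?_ hR.yang_baxter.symm).symm <;>
    rw [← atPair_mul]
  · rw [hR.inv_mul hq, atPair_one]
  · rw [hR.mul_inv hq, atPair_one]

/-- `C₁ C₂` commutes with `R₁₂`. Both are eliminated from `C₂ Ψ₁₂ C₂`: the two conjugation
identities `conjCoeff_eq` and `conjCoeff_inv_eq`, contracted with `Ψ`, say that
`C₂ Ψ₁₂ = R₂₁⁻¹ C₁` and `Ψ₁₂ C₂ = C₁ R₂₁⁻¹`. -/
theorem IsEvenHeckeSymmetry.commute_cMatrix (hR : IsEvenHeckeSymmetry q p R) (hq : q ≠ 0)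
    (hΨ : IsSkewInverse R Ψ) :
    Commute (Matrix.of fun x y : Fin n × Fin n => cMatrix Ψ x.1 y.1 * cMatrix Ψ x.2 y.2) R := by
  have h1 : ∀ u v d j, ∑ a, cMatrix Ψ a v * R⁻¹ (d, u) (j, a)
      = ∑ c, Ψ (u, c) (v, j) * cMatrix Ψ d c := by
    intro u v d j
    calc ∑ a, cMatrix Ψ a v * R⁻¹ (d, u) (j, a)
        = ∑ a, ∑ b, ∑ e, cMatrix Ψ a b * R⁻¹ (d, e) (j, a) * (if u = e ∧ b = v then 1 else 0) := by
          simp [ite_and]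
      _ = ∑ a, ∑ b, ∑ e, cMatrix Ψ a b * R⁻¹ (d, e) (j, a) *
            ∑ c, ∑ i, Ψ (u, c) (v, i) * R (i, b) (c, e) := by simp only [hΨ.left]
      _ = ∑ c, ∑ i, Ψ (u, c) (v, i) * conjCoeff (cMatrix Ψ) R R⁻¹ i j c d := by
          simp only [conjCoeff, Finset.mul_sum]
          rw [sum_comm_three_two]
          refine Finset.sum_congr rfl fun c _ => Finset.sum_congr rfl fun i _ =>
            Finset.sum_congr rfl fun a _ => Finset.sum_congr rfl fun b _ =>
            Finset.sum_congr rfl fun e _ => ?_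
          ring
      _ = _ := by simp [hR.conjCoeff_eq hq hΨ]
  have h2 : ∀ u v i c, ∑ b, cMatrix Ψ u b * R⁻¹ (i, b) (c, v)
      = ∑ d, Ψ (u, i) (v, d) * cMatrix Ψ d c := by
    intro u v i c
    calc ∑ b, cMatrix Ψ u b * R⁻¹ (i, b) (c, v)
        = ∑ a, ∑ b, ∑ e, cMatrix Ψ a b * R⁻¹ (i, b) (c, e) * (if u = a ∧ e = v then 1 else 0) := by
          simp [ite_and]
      _ = ∑ a, ∑ b, ∑ e, cMatrix Ψ a b * R⁻¹ (i, b) (c, e) *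
            ∑ j, ∑ d, Ψ (u, j) (v, d) * R (d, e) (j, a) := by simp only [hΨ.left]
      _ = ∑ j, ∑ d, Ψ (u, j) (v, d) * conjCoeff (cMatrix Ψ) R⁻¹ R i j c d := by
          simp only [conjCoeff, Finset.mul_sum]
          rw [sum_comm_three_two]
          refine Finset.sum_congr rfl fun c _ => Finset.sum_congr rfl fun i _ =>
            Finset.sum_congr rfl fun a _ => Finset.sum_congr rfl fun b _ =>
            Finset.sum_congr rfl fun e _ => ?_
          ring
      _ = _ := by simp [hR.conjCoeff_inv_eq hq hΨ]
  have h3 : Commute R⁻¹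
      (Matrix.of fun x y : Fin n × Fin n => cMatrix Ψ x.1 y.1 * cMatrix Ψ x.2 y.2) := by
    change _ = _
    ext ⟨d, u⟩ ⟨c, v⟩
    simp only [Matrix.mul_apply, Matrix.of_apply, Fintype.sum_prod_type]
    -- both sides are an entry of `C₂ Ψ₁₂ C₂`
    calc ∑ j, ∑ a, R⁻¹ (d, u) (j, a) * (cMatrix Ψ j c * cMatrix Ψ a v)
        = ∑ j, (∑ a, cMatrix Ψ a v * R⁻¹ (d, u) (j, a)) * cMatrix Ψ j c := by
          simp only [Finset.sum_mul]
          refine Finset.sum_congr rfl fun j _ => Finset.sum_congr rfl fun a _ => ?_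
          ring
      _ = ∑ j, cMatrix Ψ d j * ∑ b, Ψ (u, j) (v, b) * cMatrix Ψ b c := by
          simp only [h1, Finset.sum_mul, Finset.mul_sum]
          rw [Finset.sum_comm]
          refine Finset.sum_congr rfl fun j _ => Finset.sum_congr rfl fun a _ => ?_
          ring
      _ = _ := by
          simp only [← h2, Finset.mul_sum]
          refine Finset.sum_congr rfl fun j _ => Finset.sum_congr rfl fun a _ => ?_
          ring
  exact (commute_of_mul_eq_one (hR.inv_mul hq) (hR.mul_inv hq) h3).symm

end Skew

/-! ### Reflection equation matrices on many sites -/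

section Tower

variable {n : ℕ} {K : Type*} [Field K] {A : Type*} [Ring A] [Algebra K A] {q : K} {p : ℕ}
  {R Ψ : Matrix (Fin n × Fin n) (Fin n × Fin n) K} {L : Matrix (Fin n) (Fin n) A}

theorem addLast_map {N : ℕ} (X : Matrix (Fin N → Fin n) (Fin N → Fin n) K) :
    (addLast n N K X).map (algebraMap K A) = addLast n N A (X.map (algebraMap K A)) :=
  ampl_map _ _ _

theorem addLast_smul {N : ℕ} (c : K) (X : Matrix (Fin N → Fin n) (Fin N → Fin n) A) :
    addLast n N A (c • X) = c • addLast n N A X :=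
  ampl_smul _ _ _

theorem addLast_diagonal (N : ℕ) (s : A) :
    addLast n N A (Matrix.diagonal fun _ => s) = Matrix.diagonal fun _ => s := by
  ext f g
  rw [← Fin.snoc_init_self f, ← Fin.snoc_init_self g, addLast_apply]
  simp only [Matrix.diagonal_apply, Fin.snoc_inj, and_comm, ite_and]

theorem antisymm_eq_hAntisymm (N m : ℕ) : antisymm q R N m = hAntisymm q (atPair R N) m := by
  induction m with
  | zero => rfl
  | succ m ih =>
    cases m with
    | zero => rfl
    | succ m => simp only [antisymm, hAntisymm, ih]

theorem antisymm_addLast {N m : ℕ} (hm : m ≤ N) :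
    antisymm q R (N + 1) m = addLast n N K (antisymm q R N m) := by
  induction m with
  | zero => simp [antisymm]
  | succ m ih =>
    cases m with
    | zero => simp [antisymm]
    | succ m =>
      simp only [antisymm]
      rw [ih (by omega), atPair_addLast R (by omega)]
      simp only [addLast_smul, map_mul, map_sub, map_one]

theorem lBar_eq_conjSeq (N k : ℕ) :
    lBar R L N k = conjSeq (fun i => (atPair R N i).map (algebraMap K A))
      (fun i => (atPair R⁻¹ N i).map (algebraMap K A)) (atFirst L N) k := by
  induction k with
  | zero => rfl
  | succ k ih => simp only [lBar, conjSeq, ih]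

theorem lBar_addLast {N k : ℕ} (hk : k < N) :
    lBar R L (N + 1) k = addLast n N A (lBar R L N k) := by
  induction k with
  | zero =>
    obtain ⟨N, rfl⟩ : ∃ M, N = M + 1 := ⟨N - 1, by omega⟩
    exact atFirst_succ_succ L N
  | succ k ih =>
    simp only [lBar]
    rw [ih (by omega), atPair_addLast R (by omega), atPair_addLast _ (by omega), addLast_map,
      addLast_map, map_mul, map_mul]

theorem prod_lBar_addLast {N m : ℕ} (hm : m ≤ N) :
    (List.ofFn fun i : Fin m => lBar R L (N + 1) i).prod
      = addLast n N A (List.ofFn fun i : Fin m => lBar R L N i).prod := by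
  rw [map_list_prod, List.map_ofFn]
  congr 2
  funext i
  exact lBar_addLast (by omega)

/-- `L` satisfies the reflection equation `R L₁ R L₁ = L₁ R L₁ R`. -/
def IsREMatrix (R : Matrix (Fin n × Fin n) (Fin n × Fin n) K) (L : Matrix (Fin n) (Fin n) A) :
    Prop :=
  (R.map (algebraMap K A)) * (L ⊗ₖ (1 : Matrix (Fin n) (Fin n) A)) * (R.map (algebraMap K A)) *
      (L ⊗ₖ (1 : Matrix (Fin n) (Fin n) A))
    = (L ⊗ₖ (1 : Matrix (Fin n) (Fin n) A)) * (R.map (algebraMap K A)) *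
      (L ⊗ₖ (1 : Matrix (Fin n) (Fin n) A)) * (R.map (algebraMap K A))

theorem atFirst_eq_ampl_kronecker (L : Matrix (Fin n) (Fin n) A) (N : ℕ) :
    atFirst L (N + 2) = ampl (splitFirstPair n N) (L ⊗ₖ (1 : Matrix (Fin n) (Fin n) A)) := by
  rw [atFirst_succ]
  ext f g
  simp only [ampl_apply, splitFirst, splitFirstPair, Equiv.trans_apply, Equiv.coe_fn_mk,
    Equiv.prodComm_apply, Prod.swap, Matrix.kroneckerMap_apply, Matrix.one_apply, mul_ite, mul_one,
    mul_zero, ← ite_and]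
  refine if_congr ?_ rfl rfl
  constructor
  · intro h
    exact ⟨congrArg Fin.tail h, congrFun h 0⟩
  · rintro ⟨h1, h2⟩
    rw [← Fin.cons_self_tail (Fin.tail f), ← Fin.cons_self_tail (Fin.tail g), h1]
    exact congrArg (fun a => (Fin.cons a (Fin.tail (Fin.tail g)) : Fin (N + 1) → Fin n)) h2

theorem isReflectionFamily (hR : IsEvenHeckeSymmetry q p R) (hq : q ≠ 0) (hL : IsREMatrix R L)
    (N : ℕ) : IsReflectionFamily N (fun i => (atPair R N i).map (algebraMap K A))
      (fun i => (atPair R⁻¹ N i).map (algebraMap K A)) (atFirst L N) where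
  mul_inv i := by
    rw [← Matrix.map_mul, ← atPair_mul, hR.mul_inv hq, atPair_one]; simp
  inv_mul i := by
    rw [← Matrix.map_mul, ← atPair_mul, hR.inv_mul hq, atPair_one]; simp
  braid i hi := by
    simp only [← Matrix.map_mul, atPair_braid hR.yang_baxter hi]
  far i j hij := (commute_atPair R R N hij).map (algebraMap K A).mapMatrix
  far_gen i := commute_atPair_atFirst R L N i
  reflection hN := by
    obtain ⟨N, rfl⟩ : ∃ M, N = M + 2 := ⟨N - 2, by omega⟩
    simp only [atPair_zero, ampl_map, atFirst_eq_ampl_kronecker, ← map_mul]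
    rw [hL]

theorem isHeckeFamily (hR : IsEvenHeckeSymmetry q p R) (hq : q ≠ 0) (N : ℕ) :
    IsHeckeFamily q N (atPair R N) where
  sq i hi := by
    rw [← atPair_mul, hR.mul_self hq, atPair_add _ _ hi, atPair_smul _ _ hi, atPair_one]
  braid _ hi := atPair_braid hR.yang_baxter hi
  far _ _ hij := commute_atPair R R N hij

theorem lastTrace_conj (hR : IsEvenHeckeSymmetry q p R) (hq : q ≠ 0) (hΨ : IsSkewInverse R Ψ)
    {N : ℕ} (X : Matrix (Fin (N + 1) → Fin n) (Fin (N + 1) → Fin n) A) :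
    lastTrace (cMatrix Ψ) (N + 1) ((atPair R (N + 2) N).map (algebraMap K A) *
        addLast n (N + 1) A X * (atPair R⁻¹ (N + 2) N).map (algebraMap K A))
      = addLast n N A (lastTrace (cMatrix Ψ) N X) := by
  ext f g
  rw [← Fin.snoc_init_self f, ← Fin.snoc_init_self g, lastTrace_conj_apply, addLast_apply]
  simp only [hR.conjCoeff_eq hq hΨ, lastTrace, Matrix.of_apply]
  split_ifs
  · exact Finset.sum_comm
  · simp

theorem lastTrace_conj_inv (hR : IsEvenHeckeSymmetry q p R) (hq : q ≠ 0) (hΨ : IsSkewInverse R Ψ)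
    {N : ℕ} (X : Matrix (Fin (N + 1) → Fin n) (Fin (N + 1) → Fin n) A) :
    lastTrace (cMatrix Ψ) (N + 1) ((atPair R⁻¹ (N + 2) N).map (algebraMap K A) *
        addLast n (N + 1) A X * (atPair R (N + 2) N).map (algebraMap K A))
      = addLast n N A (lastTrace (cMatrix Ψ) N X) := by
  ext f g
  rw [← Fin.snoc_init_self f, ← Fin.snoc_init_self g, lastTrace_conj_apply, addLast_apply]
  simp only [hR.conjCoeff_inv_eq hq hΨ, lastTrace, Matrix.of_apply]
  split_ifs
  · exact Finset.sum_comm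
  · simp

theorem lastTrace_atFirst_pow (L : Matrix (Fin n) (Fin n) A) (j : ℕ) :
    lastTrace (cMatrix Ψ) 0 (atFirst L 1 ^ j) = Matrix.diagonal fun _ => rTrace Ψ (L ^ j) := by
  rw [atFirst_succ, ← map_pow]
  ext f g
  obtain rfl := Subsingleton.elim f g
  simp only [lastTrace, Matrix.of_apply, ampl_apply, Matrix.diagonal_apply_eq, rTrace, Matrix.trace,
    Matrix.diag, Matrix.mul_apply, Matrix.map_apply, Algebra.smul_def]
  refine Finset.sum_congr rfl fun a _ => Finset.sum_congr rfl fun b _ => ?_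
  rw [if_pos (Subsingleton.elim _ _)]
  rfl

/-- The partial `R`-trace of a power of `L_{\overline{m+1}}` over the last of its `m + 1` sites is
the scalar `Tr_R L^j`. -/
theorem lastTrace_lBar_pow (hR : IsEvenHeckeSymmetry q p R) (hq : q ≠ 0) (hΨ : IsSkewInverse R Ψ)
    (hL : IsREMatrix R L) (m j : ℕ) :
    lastTrace (cMatrix Ψ) m (lBar R L (m + 1) m ^ j)
      = Matrix.diagonal fun _ => rTrace Ψ (L ^ j) := by
  induction m with
  | zero => exact lastTrace_atFirst_pow L j
  | succ m ih =>
    have h := isReflectionFamily hR hq hL (m + 2)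
    simp only [lBar]
    rw [conj_pow (h.inv_mul m) (h.mul_inv m), lBar_addLast (Nat.lt_succ_self m), ← map_pow,
      lastTrace_conj hR hq hΨ, ih, addLast_diagonal]

/-- The power sums `Tr_R L^k` commute with the entries of `L`. -/
theorem commute_rTrace_pow (hR : IsEvenHeckeSymmetry q p R) (hq : q ≠ 0) (hΨ : IsSkewInverse R Ψ)
    (hL : IsREMatrix R L) (k : ℕ) (i j : Fin n) : Commute (rTrace Ψ (L ^ k)) (L i j) := by
  have h := (isReflectionFamily hR hq hL 2).mul_conj_pow (by norm_num) k
  have h' := congrArg (lastTrace (cMatrix Ψ) 1) h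
  rw [atFirst_succ_succ L 0, lastTrace_addLast_mul, lastTrace_mul_addLast, ← map_pow,
    lastTrace_conj hR hq hΨ, lastTrace_conj_inv hR hq hΨ, lastTrace_atFirst_pow,
    addLast_diagonal] at h'
  have h2 := congrFun (congrFun h' fun _ => i) fun _ => j
  rw [Matrix.mul_diagonal, Matrix.diagonal_mul] at h2
  have h3 : atFirst L 1 (fun _ => i) (fun _ => j) = L i j := by
    rw [atFirst_succ, ampl_apply, if_pos (Subsingleton.elim _ _)]; rfl
  exact (h3 ▸ h2).symm

/-! ### Newton identities -/

theorem rTraceSites_add (N : ℕ) (X Y : Matrix (Fin N → Fin n) (Fin N → Fin n) A) :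
    rTraceSites Ψ N (X + Y) = rTraceSites Ψ N X + rTraceSites Ψ N Y := by
  simp only [rTraceSites, mul_add, Matrix.trace_add]

theorem rTraceSites_smul (c : K) (N : ℕ) (X : Matrix (Fin N → Fin n) (Fin N → Fin n) A) :
    rTraceSites Ψ N (c • X) = c • rTraceSites Ψ N X := by
  simp only [rTraceSites, mul_smul_comm, Matrix.trace_smul]

theorem rTraceSites_mul_diagonal (s : A) (N : ℕ) (X : Matrix (Fin N → Fin n) (Fin N → Fin n) A) :
    rTraceSites Ψ N (X * Matrix.diagonal fun _ => s) = rTraceSites Ψ N X * s := by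
  simp only [rTraceSites, ← mul_assoc, Matrix.trace, Matrix.diag, Matrix.mul_diagonal,
    Finset.sum_mul]

theorem commute_prod_cMatrix (hR : IsEvenHeckeSymmetry q p R) (hq : q ≠ 0) (hΨ : IsSkewInverse R Ψ)
    (N i : ℕ) : Commute (Matrix.of fun f g : Fin N → Fin n => ∏ i, cMatrix Ψ (f i) (g i))
      (atPair R N i) := by
  induction i generalizing N with
  | zero =>
    rcases N with _ | _ | N
    · simp [atPair]
    · simp [atPair]
    · have : (Matrix.of fun f g : Fin (N + 2) → Fin n => ∏ i, cMatrix Ψ (f i) (g i))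
          = ampl (splitFirstPair n N) (Matrix.of fun x y : Fin n × Fin n =>
              cMatrix Ψ x.1 y.1 * cMatrix Ψ x.2 y.2) *
            ampl ((splitFirstPair n N).trans (Equiv.prodComm _ _))
              (Matrix.of fun f g : Fin N → Fin n => ∏ i, cMatrix Ψ (f i) (g i)) := by
        ext f g
        rw [ampl_mul_ampl_swap_apply]
        simp only [Matrix.of_apply, Fin.prod_univ_succ, ← mul_assoc]
        rfl
      rw [this, atPair_zero]
      exact ((hR.commute_cMatrix hq hΨ).map _).mul_left
        (commute_ampl_swap (A := K) _ _ _ fun _ _ _ _ => Commute.all _ _).symm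
  | succ i ih =>
    cases N with
    | zero => simp [atPair]
    | succ N =>
      have : (Matrix.of fun f g : Fin (N + 1) → Fin n => ∏ i, cMatrix Ψ (f i) (g i))
          = ampl (splitFirst n N)
              (Matrix.of fun f g : Fin N → Fin n => ∏ i, cMatrix Ψ (f i) (g i)) *
            ampl ((splitFirst n N).trans (Equiv.prodComm _ _)) (cMatrix Ψ) := by
        ext f g
        rw [ampl_mul_ampl_swap_apply]
        simp only [Matrix.of_apply, Fin.prod_univ_succ]
        exact mul_comm _ _
      rw [this, atPair_succ]
      exact ((ih N).map _).mul_left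
        (commute_ampl_swap (A := K) _ _ _ fun _ _ _ _ => Commute.all _ _).symm

/-- The `R`-trace over all sites is cyclic for the antisymmetrizers. -/
theorem rTraceSites_antisymm_mul (hR : IsEvenHeckeSymmetry q p R) (hq : q ≠ 0)
    (hΨ : IsSkewInverse R Ψ) (N m : ℕ) (X : Matrix (Fin N → Fin n) (Fin N → Fin n) A) :
    rTraceSites Ψ N ((antisymm q R N m).map (algebraMap K A) * X)
      = rTraceSites Ψ N (X * (antisymm q R N m).map (algebraMap K A)) := by
  have hc : Commute (antisymm q R N m)
      (Matrix.of fun f g : Fin N → Fin n => ∏ i, cMatrix Ψ (f i) (g i)) := by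
    rw [antisymm_eq_hAntisymm]
    exact commute_hAntisymm fun i _ => (commute_prod_cMatrix hR hq hΨ N i).symm
  have hc' := (hc.map (algebraMap K A).mapMatrix).eq
  simp only [RingHom.mapMatrix_apply] at hc'
  have hmap : (Matrix.of fun f g : Fin N → Fin n => algebraMap K A (∏ i, cMatrix Ψ (f i) (g i)))
      = (Matrix.of fun f g : Fin N → Fin n => ∏ i, cMatrix Ψ (f i) (g i)).map (algebraMap K A) :=
    rfl
  unfold rTraceSites
  rw [hmap, ← mul_assoc, ← hc', mul_assoc, ← mul_assoc _ X]
  -- a matrix with central entries may be moved around the trace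
  simp only [Matrix.trace, Matrix.diag, Matrix.mul_apply (M := Matrix.map _ _),
    Matrix.mul_apply (N := Matrix.map (antisymm q R N m) _), Matrix.map_apply]
  rw [Finset.sum_comm]
  simp only [Algebra.commutes]

end Tower

section Newton

variable {n : ℕ} {K : Type*} [Field K] {A : Type*} [Ring A] [Algebra K A] {q : K} {p : ℕ}
  {R Ψ : Matrix (Fin n × Fin n) (Fin n × Fin n) K} {L : Matrix (Fin n) (Fin n) A}

/-- The interpolating elements `Tr_{R(1…m)} (A^{(m)} L_{\bar 1} ⋯ L_{\overline{m-1}} L_{\bar m}^j)`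
for `m ≥ 1`, indexed by `m - 1`. They run from the power sums at `m = 1` to the
`q^{-m} σ_m` at `j = 1`. -/
def hookTrace (q : K) (R Ψ : Matrix (Fin n × Fin n) (Fin n × Fin n) K)
    (L : Matrix (Fin n) (Fin n) A) (m j : ℕ) : A :=
  rTraceSites Ψ (m + 1) ((antisymm q R (m + 1) (m + 1)).map (algebraMap K A) *
    (List.ofFn fun i : Fin m => lBar R L (m + 1) i).prod * lBar R L (m + 1) m ^ j)

/-- `σ_k(L)` for a matrix `L` over any algebra. -/
def sigmaOf (q : K) (R Ψ : Matrix (Fin n × Fin n) (Fin n × Fin n) K)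
    (L : Matrix (Fin n) (Fin n) A) (k : ℕ) : A :=
  q ^ k • rTraceSites Ψ k ((antisymm q R k k).map (algebraMap K A) *
    (List.ofFn fun i : Fin k => lBar R L k i).prod)

theorem map_antisymm (N m : ℕ) : (antisymm q R N m).map (algebraMap K A)
    = hAntisymm q (fun i => (atPair R N i).map (algebraMap K A)) m := by
  have h : ∀ X : Matrix (Fin N → Fin n) (Fin N → Fin n) K,
      X.map (algebraMap K A) = (Algebra.ofId K A).mapMatrix X := fun _ => rfl
  simp only [h]
  induction m with
  | zero => exact map_one _
  | succ m ih =>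
    cases m with
    | zero => exact map_one _
    | succ m => simp only [antisymm, hAntisymm, map_smul, map_mul, map_sub, map_one, ih]

theorem commute_map_antisymm {N m : ℕ} {z : Matrix (Fin N → Fin n) (Fin N → Fin n) A}
    (h : ∀ i, i + 1 < m → Commute ((atPair R N i).map (algebraMap K A)) z) :
    Commute ((antisymm q R N m).map (algebraMap K A)) z := by
  rw [map_antisymm]
  exact commute_hAntisymm h

theorem sigmaOf_zero : sigmaOf q R Ψ L 0 = 1 := by
  simp [sigmaOf, rTraceSites, antisymm, Matrix.trace]

theorem sigmaOf_succ (m : ℕ) : sigmaOf q R Ψ L (m + 1) = q ^ (m + 1) • hookTrace q R Ψ L m 1 := by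
  rw [sigmaOf, hookTrace, pow_one, mul_assoc]
  congr 4
  exact prod_ofFn_succ (lBar R L (m + 1)) m

theorem sigmaOf_eq_zero (hR : IsEvenHeckeSymmetry q p R) {k : ℕ} (hk : p < k) :
    sigmaOf q R Ψ L k = 0 := by
  have h : antisymm q R k (p + 1) = 0 := by
    induction k, hk using Nat.le_induction with
    | base => exact hR.antisymm_succ
    | succ k hk ih => rw [antisymm_addLast hk, ih, map_zero]
  have h' : antisymm q R k k = 0 := by
    suffices ∀ m, p + 1 ≤ m → antisymm q R k m = 0 from this k hk
    intro m hm
    induction m, hm using Nat.le_induction with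
    | base => exact h
    | succ m hm ih =>
      obtain ⟨m, rfl⟩ : ∃ l, m = l + 1 := ⟨m - 1, by omega⟩
      simp [antisymm, ih]
  simp [sigmaOf, h', rTraceSites]

/-- Multiplying `σ_m` by a power sum adds a site. -/
theorem sigmaOf_mul_rTrace (hR : IsEvenHeckeSymmetry q p R) (hq : q ≠ 0) (hΨ : IsSkewInverse R Ψ)
    (hL : IsREMatrix R L) (m j : ℕ) :
    sigmaOf q R Ψ L m * rTrace Ψ (L ^ j)
      = q ^ m • rTraceSites Ψ (m + 1) ((antisymm q R (m + 1) m).map (algebraMap K A) *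
          (List.ofFn fun i : Fin m => lBar R L (m + 1) i).prod * lBar R L (m + 1) m ^ j) := by
  rw [antisymm_addLast le_rfl, prod_lBar_addLast le_rfl, addLast_map, ← map_mul, rTraceSites_succ,
    lastTrace_addLast_mul, lastTrace_lBar_pow hR hq hΨ hL, rTraceSites_mul_diagonal, sigmaOf,
    smul_mul_assoc]

/-- The product of `σ_m` and a power sum is the sum of two neighbouring interpolating elements:
the recursion for the antisymmetrizers writes `q^m A^{(m)}` as
`(m+1)_q A^{(m+1)} + m_q A^{(m)} R_m A^{(m)}`, and in the second term `R_m` is moved to the right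
and traced away. -/
theorem sigmaOf_succ_mul_rTrace (hR : IsEvenHeckeSymmetry q p R) (hq : IsGeneric q)
    (hΨ : IsSkewInverse R Ψ) (hL : IsREMatrix R L) (m j : ℕ) :
    sigmaOf q R Ψ L (m + 1) * rTrace Ψ (L ^ j)
      = qNumber q (m + 2) • hookTrace q R Ψ L (m + 1) j
        + qNumber q (m + 1) • hookTrace q R Ψ L m (j + 1) := by
  have hfam := isReflectionFamily hR hq.1 hL (m + 2)
  have haa : antisymm q R (m + 2) (m + 1) * antisymm q R (m + 2) (m + 1)
      = antisymm q R (m + 2) (m + 1) := by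
    rw [antisymm_eq_hAntisymm]
    exact (isHeckeFamily hR hq.1 (m + 2)).hAntisymm_mul_self hq (by omega)
  have hsplit : q ^ (m + 1) • antisymm q R (m + 2) (m + 1)
      = qNumber q (m + 2) • antisymm q R (m + 2) (m + 2) + qNumber q (m + 1) •
        (antisymm q R (m + 2) (m + 1) * atPair R (m + 2) m * antisymm q R (m + 2) (m + 1)) := by
    have hne := hq.qNumber_ne_zero (m := m + 2) (by omega)
    simp only [antisymm] at haa ⊢
    rw [smul_smul, mul_inv_cancel₀ hne, one_smul, mul_sub, sub_mul]
    simp only [mul_smul_comm, smul_mul_assoc, mul_one, haa]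
    rw [sub_add_cancel]
  have hprod : ∀ k, (List.ofFn fun i : Fin k => lBar R L (m + 2) i).prod
      = (List.ofFn fun i : Fin k => conjSeq (fun i => (atPair R (m + 2) i).map (algebraMap K A))
          (fun i => (atPair R⁻¹ (m + 2) i).map (algebraMap K A)) (atFirst L (m + 2)) i).prod := by
    intro k; simp only [lBar_eq_conjSeq]
  -- the antisymmetrizer on the first `m + 1` sites commutes with the product of the `L_{\bar i}`
  have hcomm : Commute ((antisymm q R (m + 2) (m + 1)).map (algebraMap K A))
      ((List.ofFn fun i : Fin (m + 1) => lBar R L (m + 2) i).prod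
        * lBar R L (m + 2) (m + 1) ^ j) := by
    refine commute_map_antisymm fun i hi => ?_
    have h1 := hfam.commute_prod (i := i) hi (by omega)
    rw [← hprod] at h1
    refine h1.mul_right (Commute.pow_right ?_ j)
    rw [lBar_eq_conjSeq]
    exact hfam.commute_conjSeq_of_add_one_lt hi (by omega)
  have hmove : (atPair R (m + 2) m).map (algebraMap K A) *
      ((List.ofFn fun i : Fin (m + 1) => lBar R L (m + 2) i).prod
        * lBar R L (m + 2) (m + 1) ^ j)
      = addLast n (m + 1) A ((List.ofFn fun i : Fin m => lBar R L (m + 1) i).prod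
          * lBar R L (m + 1) m ^ j) *
        ((atPair R (m + 2) m).map (algebraMap K A) * addLast n (m + 1) A (lBar R L (m + 1) m)) := by
    have h1 := (hfam.commute_prod_of_le (le_refl m)).eq
    rw [← hprod] at h1
    have h2 := hfam.mul_conj_pow_conjSeq (m := m) (by omega) j
    rw [← lBar_eq_conjSeq, ← lBar_eq_conjSeq] at h2
    rw [map_mul, map_pow, ← prod_lBar_addLast (by omega), ← lBar_addLast (by omega),
      prod_ofFn_succ, ← mul_assoc, ← mul_assoc, h1, mul_assoc, mul_assoc,
      ← mul_assoc _ (lBar R L (m + 2) m), h2]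
    simp only [mul_assoc]
  have hsecond : rTraceSites Ψ (m + 2)
      ((antisymm q R (m + 2) (m + 1) * atPair R (m + 2) m * antisymm q R (m + 2) (m + 1)).map
        (algebraMap K A) * ((List.ofFn fun i : Fin (m + 1) => lBar R L (m + 2) i).prod
        * lBar R L (m + 2) (m + 1) ^ j)) = hookTrace q R Ψ L m (j + 1) := by
    rw [Matrix.map_mul, mul_assoc, hcomm.eq, ← mul_assoc, ← rTraceSites_antisymm_mul hR hq.1 hΨ,
      ← mul_assoc, ← Matrix.map_mul, ← mul_assoc (antisymm q R (m + 2) (m + 1)), haa,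
      Matrix.map_mul, mul_assoc, hmove, antisymm_addLast le_rfl, addLast_map,
      rTraceSites_succ, lastTrace_addLast_mul,
      lastTrace_addLast_mul, lastTrace_mul_addLast, lastTrace_atPair hΨ, one_mul, hookTrace,
      pow_succ]
    simp only [mul_assoc]
  rw [sigmaOf_mul_rTrace hR hq.1 hΨ hL, ← rTraceSites_smul, ← smul_mul_assoc, ← smul_mul_assoc]
  have hmap : q ^ (m + 1) • (antisymm q R (m + 2) (m + 1)).map (algebraMap K A)
      = qNumber q (m + 2) • (antisymm q R (m + 2) (m + 2)).map (algebraMap K A) +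
        qNumber q (m + 1) • (antisymm q R (m + 2) (m + 1) * atPair R (m + 2) m *
          antisymm q R (m + 2) (m + 1)).map (algebraMap K A) := by
    have h := congrArg (Algebra.ofId K A).mapMatrix hsplit
    rwa [map_add, map_smul, map_smul, map_smul] at h
  rw [show m + 1 + 1 = m + 2 from rfl, hmap, mul_assoc, add_mul, rTraceSites_add, smul_mul_assoc,
    smul_mul_assoc, rTraceSites_smul, rTraceSites_smul, hsecond, ← mul_assoc]
  rfl

theorem sigmaOf_zero_mul_rTrace (hR : IsEvenHeckeSymmetry q p R) (hq : q ≠ 0)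
    (hΨ : IsSkewInverse R Ψ) (hL : IsREMatrix R L) (j : ℕ) :
    sigmaOf q R Ψ L 0 * rTrace Ψ (L ^ j) = hookTrace q R Ψ L 0 j := by
  rw [sigmaOf_mul_rTrace hR hq hΨ hL, pow_zero, one_smul]
  rfl

/-- The Newton identities for `s_i = q Tr_R L^i` and `σ_k`, without an upper bound on `k`. -/
theorem newtonIdentities_sigmaOf (hR : IsEvenHeckeSymmetry q p R) (hq : IsGeneric q)
    (hΨ : IsSkewInverse R Ψ) (hL : IsREMatrix R L)
    (hc : ∀ i k, Commute (rTrace Ψ (L ^ i)) (sigmaOf q R Ψ L k)) (P : ℕ) :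
    NewtonIdentities q P (fun i => q • rTrace Ψ (L ^ i)) (sigmaOf q R Ψ L) := by
  -- the alternating sum telescopes
  have key : ∀ m j : ℕ, ∑ i ∈ Finset.range (m + 1),
      (-1 : A) ^ i * (sigmaOf q R Ψ L (m - i) * rTrace Ψ (L ^ (j + i + 1)))
      = qNumber q (m + 1) • hookTrace q R Ψ L m (j + 1) := by
    intro m
    induction m with
    | zero =>
      intro j
      simp [sigmaOf_zero_mul_rTrace hR hq.1 hΨ hL, hq.qNumber_one]
    | succ m ih =>
      intro j
      rw [Finset.sum_range_succ']
      have h1 : ∑ i ∈ Finset.range (m + 1), (-1 : A) ^ (i + 1) *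
          (sigmaOf q R Ψ L (m + 1 - (i + 1)) * rTrace Ψ (L ^ (j + (i + 1) + 1)))
          = - (qNumber q (m + 1) • hookTrace q R Ψ L m (j + 1 + 1)) := by
        rw [← ih (j + 1), ← Finset.sum_neg_distrib]
        refine Finset.sum_congr rfl fun i _ => ?_
        rw [Nat.add_sub_add_right, pow_succ, show j + (i + 1) + 1 = j + 1 + i + 1 by ring]
        simp
      rw [h1, pow_zero, one_mul, Nat.sub_zero, add_zero,
        sigmaOf_succ_mul_rTrace hR hq hΨ hL]
      abel
  intro k hk _
  obtain ⟨m, rfl⟩ : ∃ m, k = m + 1 := ⟨k - 1, by omega⟩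
  have hk' := key m 0
  rw [zero_add] at hk'
  rw [sigmaOf_succ, ← Finset.Ico_add_one_right_eq_Icc, Finset.sum_Ico_eq_sum_range, smul_smul]
  have hcoef : qNumber q (m + 1) * q⁻¹ ^ (m + 1 - 1) * q ^ (m + 1) = q * qNumber q (m + 1) := by
    have := hq.1
    rw [Nat.add_sub_cancel, pow_succ, inv_pow]
    field_simp
  rw [hcoef, ← smul_smul, ← hk', Finset.smul_sum]
  refine Finset.sum_congr (by simp) fun i hi => ?_
  rw [smul_mul_assoc, mul_smul_comm, (hc _ _).eq]
  rw [show 1 + i - 1 = i by omega, show m + 1 - (1 + i) = m - i by omega,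
    show 0 + i + 1 = 1 + i by ring]

end Newton

/-! ### Solving the Newton identities -/

section NewtonSolve

variable {K : Type*} [Field K] {q : K}

theorem NewtonIdentities.map {A B : Type*} [Ring A] [Algebra K A] [Ring B] [Algebra K B] {P : ℕ}
    {s σ : ℕ → A} (h : NewtonIdentities q P s σ) (f : A →ₐ[K] B) :
    NewtonIdentities q P (fun k => f (s k)) (fun k => f (σ k)) := by
  intro k hk hkP
  have := congrArg f (h k hk hkP)
  simpa only [map_sum, map_mul, map_pow, map_neg, map_one, map_smul] using this

theorem NewtonIdentities.of_map {A B : Type*} [Ring A] [Algebra K A] [Ring B] [Algebra K B] {P : ℕ}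
    {s σ : ℕ → A} (f : A →ₐ[K] B) (hf : Function.Injective f)
    (h : NewtonIdentities q P (fun k => f (s k)) (fun k => f (σ k))) :
    NewtonIdentities q P s σ := by
  intro k hk hkP
  apply hf
  simpa only [map_sum, map_mul, map_pow, map_neg, map_one, map_smul] using h k hk hkP

theorem NewtonIdentities.congr {A : Type*} [Ring A] [Algebra K A] {P : ℕ} {s s' σ σ' : ℕ → A}
    (h : NewtonIdentities q P s σ) (hs : ∀ k, 1 ≤ k → k ≤ P → s' k = s k)
    (hσ : ∀ k, σ' k = σ k) : NewtonIdentities q P s' σ' := by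
  intro k hk hkP
  rw [hσ, ← h k hk hkP]
  refine Finset.sum_congr rfl fun i hi => ?_
  rw [Finset.mem_Icc] at hi
  rw [hs i hi.1 (hi.2.trans hkP), hσ]

/-- The Newton identities determine the power sums recursively. -/
theorem NewtonIdentities.unique {A : Type*} [Ring A] [Algebra K A] {P : ℕ} {s s' σ : ℕ → A}
    (h : NewtonIdentities q P s σ) (h' : NewtonIdentities q P s' σ) (h0 : σ 0 = 1) {k : ℕ}
    (hk : 1 ≤ k) (hkP : k ≤ P) : s k = s' k := by
  induction k using Nat.strong_induction_on with
  | _ k ih =>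
    obtain ⟨m, rfl⟩ : ∃ m, k = m + 1 := ⟨k - 1, by omega⟩
    have e := (h _ hk hkP).trans (h' _ hk hkP).symm
    rw [Finset.sum_Icc_succ_top hk, Finset.sum_Icc_succ_top hk, Nat.sub_self, h0, mul_one,
      mul_one] at e
    have hsum : ∑ i ∈ Finset.Icc 1 m, (-1) ^ (i - 1) * (s i * σ (m + 1 - i))
        = ∑ i ∈ Finset.Icc 1 m, (-1) ^ (i - 1) * (s' i * σ (m + 1 - i)) := by
      refine Finset.sum_congr rfl fun i hi => ?_
      rw [Finset.mem_Icc] at hi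
      rw [ih i (by omega) hi.1 (by omega)]
    rw [hsum] at e
    exact (((isUnit_one (M := A)).neg).pow _).mul_left_cancel (add_left_cancel e)

/-- The Newton identities determine the `σ_k` from the power sums because `k_q ≠ 0`. -/
theorem NewtonIdentities.sigma_mem (hq : IsGeneric q) {A : Type*} [Ring A] [Algebra K A]
    {s σ : ℕ → A} (B : Subalgebra K A) (h : ∀ P, NewtonIdentities q P s σ) (h0 : σ 0 = 1)
    (hs : ∀ k, s k ∈ B) (k : ℕ) : σ k ∈ B := by
  induction k using Nat.strong_induction_on with
  | _ k ih =>
    rcases Nat.eq_zero_or_pos k with rfl | hk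
    · rw [h0]; exact B.one_mem
    · have hc : qNumber q k * q⁻¹ ^ (k - 1) ≠ 0 :=
        mul_ne_zero (hq.qNumber_ne_zero hk) (pow_ne_zero _ (inv_ne_zero hq.1))
      have e := h k k hk le_rfl
      rw [← inv_smul_smul₀ hc (σ k), ← e]
      refine B.smul_mem (B.sum_mem fun i hi => B.mul_mem (B.pow_mem (B.neg_mem B.one_mem) _)
        (B.mul_mem (hs i) (ih _ ?_))) _
      rw [Finset.mem_Icc] at hi
      omega

end NewtonSolve

section Interpolation

open Polynomial

variable {K : Type*} [Field K] {q : K} {S : Type*} [CommRing S] [Algebra K S] {p : ℕ}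

theorem elemSymm_zero (μ : Fin p → S) : elemSymm μ 0 = 1 := by
  simp [elemSymm]

theorem elemSymm_eq_zero (μ : Fin p → S) {k : ℕ} (hk : p < k) : elemSymm μ k = 0 := by
  rw [elemSymm, Finset.powersetCard_eq_empty.2 (by simpa using hk), Finset.sum_empty]

/-- The elementary symmetric function of the `μ_j` with `j ≠ l`. -/
def elemSymmErase (μ : Fin p → S) (l : Fin p) (k : ℕ) : S :=
  ∑ t ∈ Finset.powersetCard k (Finset.univ.erase l), ∏ i ∈ t, μ i

theorem elemSymm_succ (μ : Fin p → S) (l : Fin p) (k : ℕ) :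
    elemSymm μ (k + 1) = elemSymmErase μ l (k + 1) + μ l * elemSymmErase μ l k := by
  have hl : l ∉ (Finset.univ : Finset (Fin p)).erase l := Finset.notMem_erase _ _
  rw [elemSymm, ← Finset.insert_erase (Finset.mem_univ l), Finset.powersetCard_succ_insert hl,
    Finset.sum_union, Finset.sum_image]
  · simp only [elemSymmErase, Finset.mul_sum]
    congr 1
    refine Finset.sum_congr rfl fun t ht => ?_
    rw [Finset.prod_insert fun h => hl ((Finset.mem_powersetCard.1 ht).1 h)]
  · intro t ht t' ht' h
    have h1 : l ∉ t := fun h => hl ((Finset.mem_powersetCard.1 ht).1 h)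
    have h2 : l ∉ t' := fun h => hl ((Finset.mem_powersetCard.1 ht').1 h)
    rw [← Finset.erase_insert h1, ← Finset.erase_insert h2, h]
  · rw [Finset.disjoint_left]
    intro t ht ht'
    obtain ⟨t', -, rfl⟩ := Finset.mem_image.1 ht'
    exact hl ((Finset.mem_powersetCard.1 ht).1 (Finset.mem_insert_self _ _))

theorem sum_pow_mul_elemSymm (μ : Fin p → S) (l : Fin p) (k : ℕ) :
    ∑ i ∈ Finset.Icc 1 (k + 1), (-1) ^ (i - 1) * (μ l ^ i * elemSymm μ (k + 1 - i))
      = μ l * elemSymmErase μ l k := by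
  rw [← Finset.Ico_add_one_right_eq_Icc, Finset.sum_Ico_eq_sum_range]
  simp only [Nat.add_sub_cancel, Nat.add_sub_cancel_left]
  induction k with
  | zero => simp [elemSymm, elemSymmErase]
  | succ k ih =>
    rw [Finset.sum_range_succ']
    have h : ∑ i ∈ Finset.range (k + 1),
        (-1) ^ (i + 1) * (μ l ^ (1 + (i + 1)) * elemSymm μ (k + 1 + 1 - (1 + (i + 1))))
        = - μ l * (μ l * elemSymmErase μ l k) := by
      rw [← ih, Finset.mul_sum]
      refine Finset.sum_congr rfl fun i _ => ?_
      rw [show k + 1 + 1 - (1 + (i + 1)) = k + 1 - (1 + i) by omega]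
      ring
    rw [h, show k + 1 + 1 - (1 + 0) = k + 1 by omega, elemSymm_succ μ l]
    ring

/-- Lagrange interpolation of `∏ (x + μ_j) - ∏ (x + q⁻² μ_j)` at the nodes `-μ_l`. -/
theorem interpolation (hq : q ≠ 0) (μ : Fin p → S) (hμ : ∀ i j, i ≠ j → IsUnit (μ i - μ j)) :
    (∏ j, (X + C (μ j)) - ∏ j, (X + C (((q⁻¹) ^ 2) • μ j)) : S[X])
      = ∑ l, ((q - q⁻¹) • (q⁻¹) ^ p • (μ l * dCoeff q μ l)) •
          ∏ j ∈ Finset.univ.erase l, (X + C (μ j)) := by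
  nontriviality S
  rw [← sub_eq_zero]
  by_contra hne
  have hmonic : (∏ j, (X - C (-μ j)) : S[X]).Monic :=
    monic_prod_of_monic _ _ fun j _ => monic_X_sub_C _
  have hdeg : (∏ j, (X - C (-μ j)) : S[X]).degree = p := by
    rw [degree_prod_of_monic _ _ fun j _ => monic_X_sub_C _]
    simp
  refine hmonic.not_dvd_of_degree_lt hne ?_ ?_
  · rw [hdeg, ← mem_degreeLT]
    refine Submodule.sub_mem _ ?_ (Submodule.sum_mem _ fun l _ => Submodule.smul_mem _ _ ?_)
    · rw [mem_degreeLT]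
      have h : ∀ ν : Fin p → S, (∏ j, (X + C (ν j)) : S[X]).Monic ∧
          (∏ j, (X + C (ν j)) : S[X]).degree = p := fun ν =>
        ⟨monic_prod_of_monic _ _ fun j _ => monic_X_add_C _, by
          rw [degree_prod_of_monic _ _ fun j _ => monic_X_add_C _]; simp⟩
      have h1 := h μ
      have h2 := h fun j => ((q⁻¹) ^ 2) • μ j
      rw [← h1.2]
      exact degree_sub_lt_left (h1.2.trans h2.2.symm) h1.1.ne_zero (h1.1.trans h2.1.symm)
    · rw [mem_degreeLT, degree_prod_of_monic _ _ fun j _ => monic_X_add_C _]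
      have : p ≠ 0 := fun h => by subst h; exact l.elim0
      simp only [degree_X_add_C, Finset.sum_const, Finset.card_erase_of_mem (Finset.mem_univ l),
        Finset.card_univ, Fintype.card_fin, nsmul_eq_mul, mul_one]
      exact_mod_cast (by omega : p - 1 < p)
  · refine Fintype.prod_dvd_of_coprime (fun i j hij => isCoprime_X_sub_C_of_isUnit_sub ?_)
      fun l => ?_
    · rw [neg_sub_neg]
      exact hμ j i hij.symm
    · rw [dvd_iff_isRoot, IsRoot.def]
      simp only [eval_sub, eval_finsetSum, eval_prod, eval_smul, eval_add, eval_X, eval_C]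
      -- only the summand of `l` survives on the right, and only the second product on the left
      rw [Finset.prod_eq_zero (Finset.mem_univ l) (neg_add_cancel (μ l)),
        Finset.sum_eq_single_of_mem l (Finset.mem_univ l) (fun i _ hil => by
          rw [Finset.prod_eq_zero (Finset.mem_erase.2 ⟨hil.symm, Finset.mem_univ l⟩)
            (neg_add_cancel (μ l)), smul_zero]),
        ← Finset.mul_prod_erase Finset.univ (fun j => -μ l + (q⁻¹) ^ 2 • μ j) (Finset.mem_univ l)]
      have hd : dCoeff q μ l * ∏ j ∈ Finset.univ.erase l, (-μ l + μ j)
          = q ^ (p - 1) • ∏ j ∈ Finset.univ.erase l, (-μ l + (q⁻¹) ^ 2 • μ j) := by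
        rw [dCoeff, ← Finset.prod_mul_distrib]
        have hcard : p - 1 = ((Finset.univ : Finset (Fin p)).erase l).card := by simp
        rw [hcard, ← Finset.prod_const, ← Finset.prod_smul]
        refine Finset.prod_congr rfl fun j hj => ?_
        have hu := hμ l j (Finset.mem_erase.1 hj).1.symm
        rw [show -μ l + μ j = -(μ l - μ j) by ring, mul_neg, mul_assoc,
          Ring.inverse_mul_cancel _ hu, mul_one, neg_sub, smul_add, smul_neg, smul_smul]
        rw [show q * q⁻¹ ^ 2 = q⁻¹ by field_simp]
        ring
      rw [smul_eq_mul, smul_mul_assoc, smul_mul_assoc, mul_assoc, hd]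
      obtain ⟨m, rfl⟩ : ∃ m, p = m + 1 := ⟨p - 1, by have := l.2; omega⟩
      rw [Nat.add_sub_cancel, mul_smul_comm, smul_smul, smul_smul]
      have hc : (q - q⁻¹) * (q⁻¹ ^ (m + 1) * q ^ m) = 1 - q⁻¹ ^ 2 := by
        rw [pow_succ, inv_pow]
        field_simp
      rw [mul_assoc, hc, sub_smul, one_smul, add_mul, neg_mul, smul_mul_assoc]
      ring

theorem smul_elemSymm_succ (hq : q ≠ 0) (μ : Fin p → S) (hμ : ∀ i j, i ≠ j → IsUnit (μ i - μ j))
    (k : ℕ) : (1 - (q⁻¹) ^ (2 * (k + 1))) • elemSymm μ (k + 1)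
      = (q - q⁻¹) • (q⁻¹) ^ p • ∑ l, dCoeff q μ l * (μ l * elemSymmErase μ l k) := by
  rcases Nat.lt_or_ge p (k + 1) with hk | hk
  · have h : ∀ l, elemSymmErase μ l k = 0 := by
      intro l
      have := l.2
      rw [elemSymmErase, Finset.powersetCard_eq_empty.2, Finset.sum_empty]
      rw [Finset.card_erase_of_mem (Finset.mem_univ l), Finset.card_univ, Fintype.card_fin]
      omega
    simp [h, elemSymm_eq_zero μ hk]
  · have h := congrArg (fun f => coeff f (p - (k + 1))) (interpolation hq μ hμ)
    simp only [coeff_sub, finsetSum_coeff, coeff_smul] at h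
    rw [Finset.prod_X_add_C_coeff _ _ (by simp), Finset.prod_X_add_C_coeff _ _ (by simp)] at h
    have h1 : (Finset.univ : Finset (Fin p)).card - (p - (k + 1)) = k + 1 := by
      rw [Finset.card_univ, Fintype.card_fin]; omega
    have h2 : ∀ t ∈ Finset.powersetCard (k + 1) (Finset.univ : Finset (Fin p)),
        ∏ i ∈ t, (q⁻¹) ^ 2 • μ i = (q⁻¹) ^ (2 * (k + 1)) • ∏ i ∈ t, μ i := by
      intro t ht
      rw [Finset.prod_smul, Finset.prod_const, (Finset.mem_powersetCard.1 ht).2, pow_mul]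
    rw [h1, Finset.sum_congr rfl h2, ← Finset.smul_sum] at h
    rw [sub_smul, one_smul]
    refine h.trans ?_
    simp only [Finset.smul_sum]
    refine Finset.sum_congr rfl fun l _ => ?_
    have hcard : ((Finset.univ : Finset (Fin p)).erase l).card = p - 1 := by
      rw [Finset.card_erase_of_mem (Finset.mem_univ l), Finset.card_univ, Fintype.card_fin]
    rw [Finset.prod_X_add_C_coeff _ _ (by omega), hcard,
      show p - 1 - (p - (k + 1)) = k by omega, smul_eq_mul, smul_mul_assoc, smul_mul_assoc]
    congr 2
    change μ l * dCoeff q μ l * elemSymmErase μ l k = _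
    ring

/-- The parametrized power sums solve the Newton identities. -/
theorem newtonIdentities_elemSymm (hq : IsGeneric q) (μ : Fin p → S)
    (hμ : ∀ i j, i ≠ j → IsUnit (μ i - μ j)) (P : ℕ) :
    NewtonIdentities q P (fun k => q • (q⁻¹) ^ p • ∑ i, μ i ^ k * dCoeff q μ i)
      (elemSymm μ) := by
  intro k hk _
  obtain ⟨m, rfl⟩ : ∃ m, k = m + 1 := ⟨k - 1, by omega⟩
  have h1 : ∑ i ∈ Finset.Icc 1 (m + 1), (-1) ^ (i - 1) *
      ((q • (q⁻¹) ^ p • ∑ l, μ l ^ i * dCoeff q μ l) * elemSymm μ (m + 1 - i))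
      = q • (q⁻¹) ^ p • ∑ l, dCoeff q μ l * (μ l * elemSymmErase μ l m) := by
    simp only [← sum_pow_mul_elemSymm, smul_mul_assoc, mul_smul_comm, ← Finset.smul_sum,
      Finset.sum_mul, Finset.mul_sum]
    rw [Finset.sum_comm]
    congr 2
    refine Finset.sum_congr rfl fun l _ => Finset.sum_congr rfl fun i _ => ?_
    ring
  have h2 := smul_elemSymm_succ hq.1 μ hμ m
  have hne := hq.sub_inv_ne_zero
  have hc : qNumber q (m + 1) * q⁻¹ ^ (m + 1 - 1)
      = q * ((q - q⁻¹)⁻¹ * (1 - (q⁻¹) ^ (2 * (m + 1)))) := by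
    have := hq.1
    rw [qNumber, Nat.add_sub_cancel, div_eq_inv_mul, mul_assoc, mul_left_comm q]
    congr 1
    simp only [inv_pow]
    field_simp
    ring
  rw [h1, hc, mul_smul, mul_smul, h2, inv_smul_smul₀ hne]

end Interpolation

/-! ### The reflection equation algebra -/

section REA

variable {n : ℕ} {K : Type*} [Field K] {q : K} {p : ℕ}
  {R Ψ : Matrix (Fin n × Fin n) (Fin n × Fin n) K}

theorem isREMatrix_genMatrix (R : Matrix (Fin n × Fin n) (Fin n × Fin n) K) :
    IsREMatrix R (genMatrix R) := by
  let f : FreeAlgebra K (Fin n × Fin n) →ₐ[K] REA R := RingQuot.mkAlgHom K (RERel R)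
  have hR : R.map (algebraMap K (REA R))
      = (R.map (algebraMap K (FreeAlgebra K (Fin n × Fin n)))).map f := by
    ext x y
    simp [Matrix.map_apply]
  have hL : genMatrix R ⊗ₖ (1 : Matrix (Fin n) (Fin n) (REA R))
      = ((Matrix.of fun i j : Fin n => FreeAlgebra.ι K (i, j)) ⊗ₖ
          (1 : Matrix (Fin n) (Fin n) (FreeAlgebra K (Fin n × Fin n)))).map f := by
    ext x y
    simp only [Matrix.kroneckerMap_apply, Matrix.map_apply, map_mul, genMatrix, Matrix.of_apply,
      Matrix.one_apply]
    congr 1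
    split_ifs <;> simp
  unfold IsREMatrix
  rw [hR, hL]
  simp only [← Matrix.map_mul]
  ext x y
  simp only [Matrix.map_apply]
  exact RingQuot.mkAlgHom_rel K (RERel.entry x y)

theorem mem_center_of_commute_genMatrix {z : REA R}
    (h : ∀ i j, Commute z (genMatrix R i j)) : z ∈ Subalgebra.center K (REA R) := by
  rw [Subalgebra.mem_center_iff]
  intro b
  obtain ⟨b, rfl⟩ := RingQuot.mkAlgHom_surjective K (RERel R) b
  change Commute _ z
  induction b using FreeAlgebra.induction with
  | grade0 r => rw [AlgHom.commutes]; exact Algebra.commutes r z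
  | grade1 x => exact (h x.1 x.2).symm
  | mul a b ha hb => rw [map_mul]; exact ha.mul_left hb
  | add a b ha hb => rw [map_add]; exact ha.add_left hb

theorem rTrace_pow_mem_center (hR : IsEvenHeckeSymmetry q p R) (hq : q ≠ 0)
    (hΨ : IsSkewInverse R Ψ) (k : ℕ) :
    rTrace Ψ (genMatrix R ^ k) ∈ Subalgebra.center K (REA R) :=
  mem_center_of_commute_genMatrix
    (commute_rTrace_pow hR hq hΨ (isREMatrix_genMatrix R) k)

theorem newtonIdentities_sigma (hR : IsEvenHeckeSymmetry q p R) (hq : IsGeneric q)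
    (hΨ : IsSkewInverse R Ψ) (P : ℕ) :
    NewtonIdentities q P (powerSum q R Ψ) (sigma q R Ψ) :=
  newtonIdentities_sigmaOf hR hq hΨ (isREMatrix_genMatrix R) (fun i _ =>
    ((Subalgebra.mem_center_iff.1 (rTrace_pow_mem_center hR hq.1 hΨ i)) _).symm) P

theorem sigma_zero : sigma q R Ψ 0 = 1 := sigmaOf_zero

theorem sigma_eq_zero (hR : IsEvenHeckeSymmetry q p R) {k : ℕ} (hk : p < k) :
    sigma q R Ψ k = 0 := sigmaOf_eq_zero hR hk

theorem sigma_mem_center (hR : IsEvenHeckeSymmetry q p R) (hq : IsGeneric q)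
    (hΨ : IsSkewInverse R Ψ) (k : ℕ) : sigma q R Ψ k ∈ Subalgebra.center K (REA R) :=
  NewtonIdentities.sigma_mem hq _ (newtonIdentities_sigma hR hq hΨ) sigma_zero
    (fun i => Subalgebra.smul_mem _ (rTrace_pow_mem_center hR hq.1 hΨ i) _) k

end REA

end ReflectionEquation
end

open ReflectionEquation in
theorem mainTheorem6 {K : Type*} [Field K] {n p : ℕ} {q : K} (hq : ReflectionEquation.IsGeneric q)
    {R Ψ : Matrix (Fin n × Fin n) (Fin n × Fin n) K}
    (hR : ReflectionEquation.IsEvenHeckeSymmetry q p R)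
    (hΨ : ReflectionEquation.IsSkewInverse R Ψ)
    {S : Type*} [CommRing S] [Algebra K S] :
    -- the elements `σ_k(L̂)` and `Tr_R(L̂^k)` are central
    ∃ (hσ : ∀ k, ReflectionEquation.sigma q R Ψ k ∈
          Subalgebra.center K (ReflectionEquation.REA R))
      (hs : ∀ k, ReflectionEquation.rTrace Ψ (ReflectionEquation.genMatrix R ^ k) ∈
          Subalgebra.center K (ReflectionEquation.REA R)),
      -- they are linked by the `q`-Newton identities
      ReflectionEquation.NewtonIdentities q p
        (ReflectionEquation.powerSum q R Ψ) (ReflectionEquation.sigma q R Ψ) ∧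
      -- for any `μ` with invertible differences, the formula is the solution of these identities
      (∀ μ : Fin p → S, (∀ i j, i ≠ j → IsUnit (μ i - μ j)) →
        ∀ s : ℕ → S,
          ReflectionEquation.NewtonIdentities q p s (ReflectionEquation.elemSymm μ) ↔
            ∀ k, 1 ≤ k → k ≤ p →
              s k = q • (q⁻¹) ^ p • ∑ i, μ i ^ k * ReflectionEquation.dCoeff q μ i) ∧
      -- the traces, when the centre is mapped to a commutative algebra (an extension of the
      -- centre, or the ground field for a character) where the `σ_k(L̂)` are parametrized by `μ`
      (∀ (φ : Subalgebra.center K (ReflectionEquation.REA R) →ₐ[K] S) (μ : Fin p → S),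
        (∀ i j, i ≠ j → IsUnit (μ i - μ j)) →
        (∀ k, 1 ≤ k → k ≤ p →
          φ ⟨ReflectionEquation.sigma q R Ψ k, hσ k⟩ = ReflectionEquation.elemSymm μ k) →
        ∀ k, 1 ≤ k →
          φ ⟨ReflectionEquation.rTrace Ψ (ReflectionEquation.genMatrix R ^ k), hs k⟩
            = (q⁻¹) ^ p • ∑ i, μ i ^ k * ReflectionEquation.dCoeff q μ i) ∧
      -- the traces on the non-commutative orbit of pairwise distinct numbers `μ`
      (∀ μ : Fin p → K, Function.Injective μ →
        ∀ k, 1 ≤ k →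
          RingQuot.mkAlgHom K (ReflectionEquation.OrbitRel q R Ψ μ)
              (ReflectionEquation.rTrace Ψ (ReflectionEquation.genMatrix R ^ k))
            = algebraMap K (ReflectionEquation.NCOrbit q R Ψ μ)
                ((q⁻¹) ^ p * ∑ i, μ i ^ k *
                  ∏ j ∈ Finset.univ.erase i, (q * μ i - q⁻¹ * μ j) / (μ i - μ j))) := by
  have hσ : ∀ k, sigma q R Ψ k ∈ Subalgebra.center K (REA R) := sigma_mem_center hR hq hΨ
  have hs : ∀ k, rTrace Ψ (genMatrix R ^ k) ∈ Subalgebra.center K (REA R) :=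
    rTrace_pow_mem_center hR hq.1 hΨ
  refine ⟨hσ, hs, newtonIdentities_sigma hR hq hΨ p, ?_, ?_, ?_⟩
  · intro μ hμ s
    have hsol := newtonIdentities_elemSymm hq μ hμ p
    exact ⟨fun h k hk hkp => h.unique hsol (elemSymm_zero μ) hk hkp,
      fun h => hsol.congr h fun _ => rfl⟩
  · intro φ μ hμ hφ k hk
    -- the identities hold without an upper bound on `k`, since `σ_k = 0 = e_k` for `k > p`
    have hφ' : ∀ k, φ ⟨sigma q R Ψ k, hσ k⟩ = elemSymm μ k := by
      intro k
      rcases Nat.eq_zero_or_pos k with rfl | hk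
      · rw [elemSymm_zero, show (⟨sigma q R Ψ 0, hσ 0⟩ : Subalgebra.center K (REA R)) = 1 from
          Subtype.ext sigma_zero, map_one]
      · rcases Nat.lt_or_ge p k with hkp | hkp
        · rw [elemSymm_eq_zero μ hkp, show (⟨sigma q R Ψ k, hσ k⟩ : Subalgebra.center K (REA R)) = 0
            from Subtype.ext (sigma_eq_zero hR hkp), map_zero]
        · exact hφ k hk hkp
    have hN : NewtonIdentities q k
        (fun k => q • (⟨rTrace Ψ (genMatrix R ^ k), hs k⟩ : Subalgebra.center K (REA R)))
        (fun k => ⟨sigma q R Ψ k, hσ k⟩) :=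
      NewtonIdentities.of_map (Subalgebra.val _) Subtype.val_injective
        (newtonIdentities_sigma hR hq hΨ k)
    have hN' := (hN.map φ).congr (fun _ _ _ => rfl) fun k => (hφ' k).symm
    have h := hN'.unique (newtonIdentities_elemSymm hq μ hμ k) (elemSymm_zero μ) hk le_rfl
    rw [map_smul] at h
    exact (IsUnit.mk0 q hq.1).smul_left_cancel.1 h
  · intro μ hμ k hk
    have hμ' : ∀ i j, i ≠ j → IsUnit (μ i - μ j) := fun i j hij =>
      (sub_ne_zero.2 (hμ.ne hij)).isUnit
    let π : REA R →ₐ[K] NCOrbit q R Ψ μ := RingQuot.mkAlgHom K (OrbitRel q R Ψ μ)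
    have hπ : ∀ k, π (sigma q R Ψ k) = algebraMap K (NCOrbit q R Ψ μ) (elemSymm μ k) := by
      intro k
      rcases Nat.eq_zero_or_pos k with rfl | hk
      · rw [elemSymm_zero, sigma_zero, map_one, map_one]
      · rcases Nat.lt_or_ge p k with hkp | hkp
        · rw [elemSymm_eq_zero μ hkp, sigma_eq_zero hR hkp, map_zero, map_zero]
        · exact (RingQuot.mkAlgHom_rel K (OrbitRel.mk k hk hkp)).trans (π.commutes _)
    have hN : NewtonIdentities q k (fun k => π (powerSum q R Ψ k))
        (fun k => algebraMap K (NCOrbit q R Ψ μ) (elemSymm μ k)) :=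
      ((newtonIdentities_sigma hR hq hΨ k).map π).congr (fun _ _ _ => rfl) fun k => (hπ k).symm
    have hN' := (newtonIdentities_elemSymm hq μ hμ' k).map (B := NCOrbit q R Ψ μ)
      (Algebra.ofId K (NCOrbit q R Ψ μ))
    have h := hN.unique (σ := fun k => algebraMap K (NCOrbit q R Ψ μ) (elemSymm μ k)) hN'
      (by rw [elemSymm_zero, map_one]) hk le_rfl
    have hd : ∀ i, dCoeff q μ i
        = ∏ j ∈ Finset.univ.erase i, (q * μ i - q⁻¹ * μ j) / (μ i - μ j) := fun i => by
      simp only [dCoeff, Ring.inverse_eq_inv', smul_eq_mul, div_eq_mul_inv]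
    simp only [powerSum, map_smul, hd] at h
    refine ((IsUnit.mk0 q hq.1).smul_left_cancel.1 h).trans ?_
    rw [← map_smul, smul_eq_mul]
    rfl
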